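/- Let $\mathbb K\in\{\mathbb R,\mathbb C\}$; all operators are bounded, linear, between Banach spaces over $\mathbb K$, and $B_X$, $S_X$ denote the closed unit ball and unit sphere of $X$. **Trees.** A tree on a set $\Lambda$ is a set $T$ of nonempty finite sequences in $\Lambda$ closed under nonempty initial segments; $s\le t$ means that $s$ is an initial segment of $t$. Let $T'$ be $T$ without its $\le$-maximal members, $T^0=T$, $T^{\zeta+1}=(T^\zeta)'$, and $T^\zeta=\bigcap_{\gamma<\zeta}T^\gamma$ for limit $\zeta$; write $o(T)=\zeta$ if $\zeta$ is the least ordinal with $T^\zeta=\varnothing$. For a (nonempty) directed set $D$, let $T.D$ be the tree of all sequences $(\zeta_i,u_i)_{i=1}^n$ with $(\zeta_i)_{i=1}^n\in T$ and $u_i\in D$. A collection $(x_t)_{t\in T.D}$ in $X$ (resp. $(y^*_t)_{t\in T.D}$ in $Y^*$) is weakly null (resp. weak$^*$ null) if for every (possibly empty) finite sequence $t$ in $\Lambda\times D$ and every $\zeta\in\Lambda$ with $t\smallfrown(\zeta,u)\in T.D$ for all $u\in D$, the net $(x_{t\smallfrown(\zeta,u)})_{u\in D}$ converges weakly to $0$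 (resp. $(y^*_{t\smallfrown(\zeta,u)})_{u\in D}$ converges weak$^*$ to $0$). **Moduli.** Let $\xi$ be an ordinal and $A:X\to Y$ a nonzero operator. For $\sigma>0$ let $$\varrho_\xi(\sigma,A)=\sup\Bigl\{\inf\bigl\{\|y+Ax\|-1:\ t\in T.D,\ x\in\mathrm{co}(x_s:\varnothing<s\le t)\bigr\}\Bigr\},$$ the supremum being over all $y\in B_Y$, all trees $T$ with $o(T)=\omega^\xi$, all directed sets $D$ and all weakly null collections $(x_t)_{t\in T.D}\subset\sigma B_X$. For $\tau>0$ let $$\delta^{\text{weak}^*}_\xi(\tau,A)=\inf\Bigl\{\sup_{t\in T.D}\bigl\|y^*+\sum_{\varnothing<s\le t}y^*_s\bigr\|-1\Bigr\}\in[0,\infty],$$ the infimum being over all $y^*\in S_{Y^*}$, all trees $T$ with $o(T)=\omega^\xi$, all directed sets $D$ and all weak$^*$ null collections $(y^*_t)_{t\in T.D}\subset Y^*$ with $\|A^*y^*_t\|\ge\tau$ for all $t\in T.D$ (with $\inf\varnothing=\infty$). **Injective tensor products.** $X\hat\otimes_\varepsilon Y$ is the operator norm closure, in the bounded operators from $X^*$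 to $Y$, of the finite sums of operators $x\otimes y:x^*\mapsto x^*(x)y$. For operators $A_0:X_0\to Y_0$ and $A_1:X_1\to Y_1$, $A_0\otimes A_1:X_0\hat\otimes_\varepsilon X_1\to Y_0\hat\otimes_\varepsilon Y_1$ is the unique bounded linear operator with $x_0\otimes x_1\mapsto A_0x_0\otimes A_1x_1$. **Lemma.** Let $A_0:X_0\to Y_0$ and $A_1:X_1\to Y_1$ be nonzero operators, let $\xi$ be an ordinal, let $R=\max\{\|A_0\|,\|A_1\|\}$, and define $$\delta(\tau)=\min\{\delta^{\text{weak}^*}_\xi(\tau,A_0),\,\delta^{\text{weak}^*}_\xi(\tau,A_1)\}.$$ Then for all $\sigma,\tau>0$, if $\delta(\tau)\ge\sigma\tau$, then $$\varrho_\xi\Bigl(\frac{\sigma}{8R},\,A_0\otimes A_1\Bigr)\le\sigma\tau .$$ -/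

import Mathlib

set_option maxSynthPendingDepth 3

open Filter Topology

universe u

namespace XiAsymptotic

/-! ### Trees -/

/-- A tree on `Λ`: a set of nonempty finite sequences in `Λ` that contains every nonempty
initial segment of each of its members. -/
def IsTree {Λ : Type u} (T : Set (List Λ)) : Prop :=
  [] ∉ T ∧ ∀ s t : List Λ, s ≠ [] → s <+: t → t ∈ T → s ∈ T

/-- The maximal members of `T`: those that have no proper extension in `T`. -/
def maxMembers {Λ : Type u} (T : Set (List Λ)) : Set (List Λ) :=
  {t | t ∈ T ∧ ∀ s ∈ T, t <+: s → s = t}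

/-- The transfinite derived trees `T ^ ζ`: start with `T`, remove the maximal members at
successors, and take intersections at limits. -/
noncomputable def derivedTree {Λ : Type u} (T : Set (List Λ)) (ζ : Ordinal.{u}) :
    Set (List Λ) :=
  Ordinal.limitRecOn ζ T (fun _ S => S \ maxMembers S) (fun η _ S => ⋂ (γ) (h : γ < η), S γ h)

/-- `o(T) = ζ`: the tree is well-founded, and `ζ` is the least ordinal at which the derived tree
is empty. -/
def HasOrder {Λ : Type u} (T : Set (List Λ)) (ζ : Ordinal.{u}) : Prop :=
  IsLeast {η : Ordinal.{u} | derivedTree T η = ∅} ζ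

/-- The tree `T.D` on `Λ × D`: all sequences of pairs whose first coordinates form a member
of `T`. -/
def treeDot {Λ : Type u} (T : Set (List Λ)) (D : Type u) : Set (List (Λ × D)) :=
  {t | t.map Prod.fst ∈ T}

/-! ### Weakly null and weak* null collections -/

section Collections

variable {𝕜 : Type} [RCLike 𝕜]
variable {X : Type u} [NormedAddCommGroup X] [NormedSpace 𝕜 X]
variable {Y : Type u} [NormedAddCommGroup Y] [NormedSpace 𝕜 Y]
variable {Λ D : Type u}

/-- The collection `(x_t)`, `t ∈ T.D`, is weakly null: whenever all `t ⌢ (ζ, u)`, `u ∈ D`, belong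
to `T.D`, the net `(x_{t ⌢ (ζ, u)})`, `u ∈ D`, converges weakly to `0`. (Then `t` is automatically
empty or a non-maximal member of `T.D`. Values of `x` off `T.D` play no role.) -/
def IsWeaklyNull (𝕜 : Type) [RCLike 𝕜] {X : Type u} [NormedAddCommGroup X] [NormedSpace 𝕜 X]
    {Λ D : Type u} [Preorder D] (T : Set (List Λ)) (x : List (Λ × D) → X) : Prop :=
  ∀ (t : List (Λ × D)) (ζ : Λ), (∀ u : D, t ++ [(ζ, u)] ∈ treeDot T D) →
    ∀ f : X →L[𝕜] 𝕜, Tendsto (fun u : D => f (x (t ++ [(ζ, u)]))) atTop (𝓝 0)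

/-- The collection `(y*_t)`, `t ∈ T.D`, in the dual of `Y` is weak* null: the same with weak*
convergence to `0` of the nets. -/
def IsWeakStarNull [Preorder D] (T : Set (List Λ)) (y' : List (Λ × D) → (Y →L[𝕜] 𝕜)) : Prop :=
  ∀ (t : List (Λ × D)) (ζ : Λ), (∀ u : D, t ++ [(ζ, u)] ∈ treeDot T D) →
    ∀ y : Y, Tendsto (fun u : D => y' (t ++ [(ζ, u)]) y) atTop (𝓝 0)

/-- The convex hull of `{x_s : ∅ < s ≤ t}`. The nonempty initial segments of `t` are
`t.take (i + 1)`, `i < t.length`. -/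
def branchHull (𝕜 : Type) [RCLike 𝕜] {X : Type u} [NormedAddCommGroup X] [NormedSpace 𝕜 X]
    {M : Type u} (x : List M → X) (t : List M) : Set X :=
  {z | ∃ a : ℕ → ℝ, (∀ i < t.length, 0 ≤ a i) ∧ ∑ i ∈ Finset.range t.length, a i = 1 ∧
    z = ∑ i ∈ Finset.range t.length, (a i : 𝕜) • x (t.take (i + 1))}

/-- The sum of `y_s` over the nonempty initial segments `s` of `t`. -/
def branchSum {E : Type u} [AddCommMonoid E] {M : Type u} (y : List M → E) (t : List M) : E :=
  ∑ i ∈ Finset.range t.length, y (t.take (i + 1))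

/-- The `ξ`-asymptotic smoothness modulus `ϱ_ξ(σ, A)` (for `σ > 0` and `A ≠ 0`), as an extended
real number: the supremum, over all `y` in the closed unit ball of `Y`, all trees `T` with
`o(T) = ω ^ ξ`, all directed sets `D` and all weakly null collections `(x_t)`, `t ∈ T.D`, in
`σ B_X`, of the infimum of `‖y + A x‖ - 1` over `t ∈ T.D` and `x ∈ co (x_s : ∅ < s ≤ t)`. -/
noncomputable def smoothnessModulus (ξ : Ordinal.{u}) (σ : ℝ) (A : X →L[𝕜] Y) : EReal :=
  sSup {r : EReal | ∃ (Λ D : Type u) (_ : Preorder D) (_ : IsDirected D (· ≤ ·)) (_ : Nonempty D)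
    (T : Set (List Λ)) (y : Y) (x : List (Λ × D) → X),
    IsTree T ∧ HasOrder T (Ordinal.omega0 ^ ξ) ∧ ‖y‖ ≤ 1 ∧
    IsWeaklyNull 𝕜 T x ∧ (∀ t ∈ treeDot T D, ‖x t‖ ≤ σ) ∧
    r = ⨅ t ∈ treeDot T D, ⨅ z ∈ branchHull 𝕜 x t, ((‖y + A z‖ - 1 : ℝ) : EReal)}

/-- The weak*-`ξ`-convexity modulus of `A` at `τ`, as an extended real number: the infimum, over
all `y*` in the unit sphere of the dual of `Y`, all trees `T` with `o(T) = ω ^ ξ`, all directed sets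
`D` and all weak* null collections `(y*_t)`, `t ∈ T.D`, with `‖A* y*_t‖ ≥ τ` for all `t ∈ T.D`, of
the supremum of `‖y* + ∑_{∅ < s ≤ t} y*_s‖ - 1` over `t ∈ T.D`. It is `∞` if there is no such
collection. -/
noncomputable def convexityModulus (ξ : Ordinal.{u}) (τ : ℝ) (A : X →L[𝕜] Y) : EReal :=
  sInf {r : EReal | ∃ (Λ D : Type u) (_ : Preorder D) (_ : IsDirected D (· ≤ ·)) (_ : Nonempty D)
    (T : Set (List Λ)) (y' : Y →L[𝕜] 𝕜) (w : List (Λ × D) → (Y →L[𝕜] 𝕜)),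
    IsTree T ∧ HasOrder T (Ordinal.omega0 ^ ξ) ∧ ‖y'‖ = 1 ∧
    IsWeakStarNull T w ∧ (∀ t ∈ treeDot T D, τ ≤ ‖(w t).comp A‖) ∧
    r = ⨆ t ∈ treeDot T D, ((‖y' + branchSum w t‖ - 1 : ℝ) : EReal)}

end Collections

/-! ### Injective tensor products -/

section Injective

variable {𝕜 : Type} [RCLike 𝕜]
variable {X Y X₀ Y₀ X₁ Y₁ : Type u}
variable [NormedAddCommGroup X] [NormedSpace 𝕜 X] [NormedAddCommGroup Y] [NormedSpace 𝕜 Y]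
variable [NormedAddCommGroup X₀] [NormedSpace 𝕜 X₀] [NormedAddCommGroup Y₀] [NormedSpace 𝕜 Y₀]
variable [NormedAddCommGroup X₁] [NormedSpace 𝕜 X₁] [NormedAddCommGroup Y₁] [NormedSpace 𝕜 Y₁]

/-- The operator `x ⊗ y` from the dual of `X` to `Y`, `x* ↦ x*(x) y`. -/
noncomputable def elemTensor (𝕜 : Type) [RCLike 𝕜] {X Y : Type u}
    [NormedAddCommGroup X] [NormedSpace 𝕜 X] [NormedAddCommGroup Y] [NormedSpace 𝕜 Y]
    (x : X) (y : Y) : (X →L[𝕜] 𝕜) →L[𝕜] Y :=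
  (ContinuousLinearMap.apply 𝕜 𝕜 x).smulRight y

theorem elemTensor_apply (x : X) (y : Y) (f : X →L[𝕜] 𝕜) :
    elemTensor 𝕜 x y f = f x • y := by
  simp [elemTensor]

/-- The injective tensor product of `X` and `Y`: the operator norm closure, among the bounded
operators from the dual of `X` to `Y`, of the finite sums of operators `x ⊗ y`. It carries the
operator norm. -/
noncomputable def InjTensor (𝕜 : Type) [RCLike 𝕜] (X Y : Type u)
    [NormedAddCommGroup X] [NormedSpace 𝕜 X] [NormedAddCommGroup Y] [NormedSpace 𝕜 Y] :
    Submodule 𝕜 ((X →L[𝕜] 𝕜) →L[𝕜] Y) :=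
  (Submodule.span 𝕜 {v | ∃ (x : X) (y : Y), v = elemTensor 𝕜 x y}).topologicalClosure

noncomputable instance instNormedAddCommGroupInjTensor :
    NormedAddCommGroup (InjTensor 𝕜 X Y) :=
  Submodule.normedAddCommGroup (InjTensor 𝕜 X Y)

noncomputable instance instNormedSpaceInjTensor : NormedSpace 𝕜 (InjTensor 𝕜 X Y) :=
  Submodule.normedSpace (InjTensor 𝕜 X Y)

theorem elemTensor_mem (x : X) (y : Y) : elemTensor 𝕜 x y ∈ InjTensor 𝕜 X Y :=
  Submodule.le_topologicalClosure _ (Submodule.subset_span ⟨x, y, rfl⟩)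

/-- The bounded operator `v ↦ A₁ ∘ v ∘ A₀*` on all bounded operators `v` from the dual of `X₀`
to `X₁`. -/
noncomputable def sandwich (A₀ : X₀ →L[𝕜] Y₀) (A₁ : X₁ →L[𝕜] Y₁) :
    ((X₀ →L[𝕜] 𝕜) →L[𝕜] X₁) →L[𝕜] ((Y₀ →L[𝕜] 𝕜) →L[𝕜] Y₁) :=
  (ContinuousLinearMap.compL 𝕜 (Y₀ →L[𝕜] 𝕜) X₁ Y₁ A₁).comp
    ((ContinuousLinearMap.compL 𝕜 (Y₀ →L[𝕜] 𝕜) (X₀ →L[𝕜] 𝕜) X₁).flip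
      ((ContinuousLinearMap.compL 𝕜 X₀ Y₀ 𝕜).flip A₀))

theorem sandwich_apply (A₀ : X₀ →L[𝕜] Y₀) (A₁ : X₁ →L[𝕜] Y₁)
    (v : (X₀ →L[𝕜] 𝕜) →L[𝕜] X₁) (f : Y₀ →L[𝕜] 𝕜) :
    sandwich A₀ A₁ v f = A₁ (v (f.comp A₀)) := rfl

theorem sandwich_elemTensor (A₀ : X₀ →L[𝕜] Y₀) (A₁ : X₁ →L[𝕜] Y₁) (x₀ : X₀) (x₁ : X₁) :
    sandwich A₀ A₁ (elemTensor 𝕜 x₀ x₁) = elemTensor 𝕜 (A₀ x₀) (A₁ x₁) := by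
  ext f
  simp [sandwich_apply, elemTensor_apply]

theorem sandwich_mem (A₀ : X₀ →L[𝕜] Y₀) (A₁ : X₁ →L[𝕜] Y₁)
    {v : (X₀ →L[𝕜] 𝕜) →L[𝕜] X₁} (hv : v ∈ InjTensor 𝕜 X₀ X₁) :
    sandwich A₀ A₁ v ∈ InjTensor 𝕜 Y₀ Y₁ := by
  refine map_mem_closure (sandwich A₀ A₁).continuous hv ?_
  intro w hw
  have hle : Submodule.span 𝕜 {v | ∃ (x : X₀) (y : X₁), v = elemTensor 𝕜 x y} ≤
      (Submodule.span 𝕜 {v | ∃ (x : Y₀) (y : Y₁), v = elemTensor 𝕜 x y}).comap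
        (sandwich A₀ A₁).toLinearMap := by
    refine Submodule.span_le.2 ?_
    rintro _ ⟨x, y, rfl⟩
    exact Submodule.subset_span ⟨A₀ x, A₁ y, sandwich_elemTensor A₀ A₁ x y⟩
  exact hle hw

/-- The operator `A₀ ⊗ A₁` between injective tensor products: the bounded linear extension of
`x₀ ⊗ x₁ ↦ A₀ x₀ ⊗ A₁ x₁`, which is `v ↦ A₁ ∘ v ∘ A₀*`. -/
noncomputable def tensorMap (A₀ : X₀ →L[𝕜] Y₀) (A₁ : X₁ →L[𝕜] Y₁) :
    InjTensor 𝕜 X₀ X₁ →L[𝕜] InjTensor 𝕜 Y₀ Y₁ :=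
  ((sandwich A₀ A₁).comp (InjTensor 𝕜 X₀ X₁).subtypeL).codRestrict (InjTensor 𝕜 Y₀ Y₁)
    (fun v => sandwich_mem A₀ A₁ v.2)

theorem tensorMap_elemTensor (A₀ : X₀ →L[𝕜] Y₀) (A₁ : X₁ →L[𝕜] Y₁) (x₀ : X₀) (x₁ : X₁) :
    tensorMap A₀ A₁ ⟨elemTensor 𝕜 x₀ x₁, elemTensor_mem x₀ x₁⟩ =
      ⟨elemTensor 𝕜 (A₀ x₀) (A₁ x₁), elemTensor_mem (A₀ x₀) (A₁ x₁)⟩ :=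
  Subtype.ext (sandwich_elemTensor A₀ A₁ x₀ x₁)

end Injective

end XiAsymptotic

/-! Elements of the injective tensor product are functions on the compact product `K` of the two
dual balls, with weak* topologies, and the norm of `v` is the supremum of `pairing v` over `K`.
Suppose the smoothness modulus exceeds `σ * τ`. Then there are `y` and a weakly null family such
that every convex combination `z` along a branch satisfies `‖y + (A₀ ⊗ A₁) z‖ > 1 + c` for some `c >
σ * τ`.

Fix `b` strictly between `σ * τ` and `c`. Two points of `K` are related when their adjoint images
are far apart compared with `b + 1 - pairing y`. Where no two points are related, pointwise
convergence to `0` becomes domination by `b + 1 - pairing y` up to a small error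
(`eventually_pairing_le`). If the `ω ^ ξ`-th derivative of `K` for this relation were empty,
transfinite averaging (`hasSmallAverages_omega0_opow`) would produce a convex combination with norm
below `1 + c`. So that derivative contains some point `k`.

Since `ω ^ ξ` is closed under natural sums, derivatives of a product cannot survive to stage `ω ^ ξ`
unless those of a factor do (`mem_iterDeriv_fst_or_snd`). Hence one coordinate `p` of `k` survives
`ω ^ ξ` derivations of its own dual ball. Walking from `p` through the derivatives along decreasing
ordinals gives a weak* null family whose convexity bound is below `σ * τ` (`convexityModulus_lt`),
against the hypothesis. -/

namespace XiAsymptotic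

/-! ### Natural sums of ordinals -/

/-- The natural (Hessenberg) sum of two ordinals: the least operation that is strictly monotone
in both arguments. -/
noncomputable def naturalSum (a b : Ordinal.{u}) : Ordinal.{u} :=
  max (⨆ x : Set.Iio a, naturalSum x.1 b + 1) (⨆ y : Set.Iio b, naturalSum a y.1 + 1)
termination_by (a, b)
decreasing_by
  · exact Prod.Lex.left _ _ x.2
  · exact Prod.Lex.right _ y.2

theorem naturalSum_le_iff {a b c : Ordinal.{u}} :
    naturalSum a b ≤ c ↔ (∀ x < a, naturalSum x b < c) ∧ ∀ y < b, naturalSum a y < c := by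
  rw [naturalSum, max_le_iff, Ordinal.iSup_le_iff, Ordinal.iSup_le_iff]
  simp [Order.add_one_le_iff]

theorem naturalSum_lt_left {x a b : Ordinal.{u}} (h : x < a) : naturalSum x b < naturalSum a b :=
  (naturalSum_le_iff.1 le_rfl).1 x h

theorem naturalSum_lt_right {y a b : Ordinal.{u}} (h : y < b) : naturalSum a y < naturalSum a b :=
  (naturalSum_le_iff.1 le_rfl).2 y h

theorem mul_add_lt_mul {p x : Ordinal.{u}} {i j : ℕ} (hx : x < p) (hij : i < j) :
    p * i + x < p * j := by
  calc p * i + x < p * i + p := by gcongr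
    _ = p * (i + 1 : ℕ) := by push_cast; rw [mul_add_one]
    _ ≤ p * j := by gcongr; exact_mod_cast hij

theorem exists_nat_of_lt_opow_succ {ξ a : Ordinal.{u}}
    (ha : a < Ordinal.omega0 ^ (ξ + 1)) :
    ∃ (n : ℕ) (r : Ordinal.{u}), r < Ordinal.omega0 ^ ξ ∧ a = Ordinal.omega0 ^ ξ * n + r := by
  rw [Ordinal.opow_add_one, Ordinal.lt_mul_iff] at ha
  obtain ⟨q, hq, r, hr, rfl⟩ := ha
  obtain ⟨n, rfl⟩ := Ordinal.lt_omega0.1 hq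
  exact ⟨n, r, hr, rfl⟩

/-- Lowering one argument either lowers its number of full blocks `p`, and the remainders, whose
natural sum is below `p`, cannot make up the lost block, or keeps the blocks and lowers a remainder.
Double induction on the arguments then suffices. -/
theorem naturalSum_mul_add_le {p : Ordinal.{u}}
    (hp : ∀ r < p, ∀ s < p, naturalSum r s < p) :
    ∀ r < p, ∀ s < p, ∀ i j : ℕ,
      naturalSum (p * i + r) (p * j + s) ≤ p * (i + j : ℕ) + naturalSum r s := by
  have key : ∀ a b : Ordinal.{u}, ∀ r < p, ∀ s < p, ∀ i j : ℕ, a = p * i + r → b = p * j + s →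
      naturalSum a b ≤ p * (i + j : ℕ) + naturalSum r s := by
    intro a
    induction a using WellFoundedLT.induction with | _ a iha =>
    intro b
    induction b using WellFoundedLT.induction with | _ b ihb =>
    intro r hr s hs i j ha hb
    have split : ∀ (k : ℕ) (t x : Ordinal.{u}), t < p → x < p * k + t →
        ∃ (k' : ℕ) (t' : Ordinal.{u}), t' < p ∧ x = p * k' + t' ∧
          (k' < k ∨ (k' = k ∧ t' < t)) := by
      intro k t x ht hx
      have hx' : x < p * (k + 1 : ℕ) := by
        refine hx.trans ?_
        exact mul_add_lt_mul ht (Nat.lt_succ_self k)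
      obtain ⟨q, hq, t', ht', rfl⟩ := Ordinal.lt_mul_iff.1 hx'
      obtain ⟨k', rfl⟩ := Ordinal.lt_omega0.1 (hq.trans (Ordinal.natCast_lt_omega0 _))
      refine ⟨k', t', ht', rfl, ?_⟩
      have hk' : k' < k + 1 := by exact_mod_cast hq
      rcases Nat.lt_succ_iff_lt_or_eq.1 hk' with h | h
      · exact Or.inl h
      · subst h
        exact Or.inr ⟨rfl, (add_lt_add_iff_left _).1 hx⟩
    refine naturalSum_le_iff.2 ⟨fun x hx => ?_, fun y hy => ?_⟩
    · obtain ⟨i', r', hr', hx', h⟩ := split i r x hr (ha ▸ hx)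
      refine (iha x hx b r' hr' s hs i' j hx' hb).trans_lt ?_
      rcases h with h | ⟨rfl, h⟩
      · exact (mul_add_lt_mul (hp _ hr' _ hs) (Nat.add_lt_add_right h j)).trans_le le_self_add
      · gcongr
        exact naturalSum_lt_left h
    · obtain ⟨j', s', hs', hy', h⟩ := split j s y hs (hb ▸ hy)
      refine (ihb y hy r hr s' hs' i j' ha hy').trans_lt ?_
      rcases h with h | ⟨rfl, h⟩
      · exact (mul_add_lt_mul (hp _ hr _ hs') (Nat.add_lt_add_left h i)).trans_le le_self_add
      · gcongr
        exact naturalSum_lt_right h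
  intro r hr s hs i j
  exact key _ _ r hr s hs i j rfl rfl

/-- At a successor, both arguments consist of finitely many blocks `ω ^ ξ` and a remainder, and
block counts add. At a limit, both arguments already lie below one smaller power. -/
theorem naturalSum_lt_omega0_opow (ξ : Ordinal.{u}) :
    ∀ a < Ordinal.omega0 ^ ξ, ∀ b < Ordinal.omega0 ^ ξ,
      naturalSum a b < Ordinal.omega0 ^ ξ := by
  induction ξ using Ordinal.limitRecOn with
  | zero =>
    intro a ha b hb
    rw [Ordinal.opow_zero, Order.lt_one_iff] at *
    subst ha hb
    exact le_antisymm (naturalSum_le_iff.2 (by simp)) zero_le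
  | add_one ξ ih =>
    intro a ha b hb
    obtain ⟨i, r, hr, rfl⟩ := exists_nat_of_lt_opow_succ ha
    obtain ⟨j, s, hs, rfl⟩ := exists_nat_of_lt_opow_succ hb
    refine (naturalSum_mul_add_le ih r hr s hs i j).trans_lt ?_
    refine (mul_add_lt_mul (ih r hr s hs) (Nat.lt_succ_self _)).trans_le ?_
    rw [Ordinal.opow_add_one]
    gcongr
    exact (Ordinal.natCast_lt_omega0 _).le
  | limit ξ hξ ih =>
    intro a ha b hb
    obtain ⟨c, hc, hac⟩ := (Ordinal.lt_opow_of_isSuccLimit Ordinal.omega0_ne_zero hξ).1 ha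
    obtain ⟨d, hd, hbd⟩ := (Ordinal.lt_opow_of_isSuccLimit Ordinal.omega0_ne_zero hξ).1 hb
    have hm : max c d < ξ := max_lt hc hd
    have hmono : ∀ e ≤ max c d, Ordinal.omega0 ^ e ≤ Ordinal.omega0 ^ max c d :=
      fun e he => Ordinal.opow_le_opow_right Ordinal.omega0_pos he
    refine (ih _ hm a (hac.trans_le (hmono _ (le_max_left _ _))) b
      (hbd.trans_le (hmono _ (le_max_right _ _)))).trans_le ?_
    exact Ordinal.opow_le_opow_right Ordinal.omega0_pos hm.le

/-! ### Derivations defined by a relation -/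

section Derivation

universe v
variable {Q : Type v} [TopologicalSpace Q]

/-- The derivation of `L` by `r`: the points all of whose neighbourhoods contain two points of `L`
that are related by `r`. -/
def relDeriv (r : Q → Q → Prop) (L : Set Q) : Set Q :=
  {k | k ∈ L ∧ ∀ V ∈ 𝓝 k, ∃ p ∈ V ∩ L, ∃ q ∈ V ∩ L, r p q}

/-- The transfinite iterates of the derivation by `r`. -/
noncomputable def iterDeriv (r : Q → Q → Prop) (ζ : Ordinal.{u}) (L : Set Q) : Set Q :=
  L ∩ ⋂ γ : Set.Iio ζ, relDeriv r (iterDeriv r γ.1 L)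
termination_by ζ
decreasing_by exact γ.2

variable {r : Q → Q → Prop} {L L' : Set Q}

theorem relDeriv_subset : relDeriv r L ⊆ L := fun _ h => h.1

theorem relDeriv_mono (h : L ⊆ L') : relDeriv r L ⊆ relDeriv r L' := by
  rintro k ⟨hk, hV⟩
  refine ⟨h hk, fun V hVk => ?_⟩
  obtain ⟨p, hp, q, hq, hr⟩ := hV V hVk
  exact ⟨p, ⟨hp.1, h hp.2⟩, q, ⟨hq.1, h hq.2⟩, hr⟩

theorem isClosed_relDeriv (hL : IsClosed L) : IsClosed (relDeriv r L) := by
  refine isClosed_of_closure_subset fun k hk => ⟨?_, fun V hV => ?_⟩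
  · exact hL.closure_subset_iff.2 relDeriv_subset hk
  · obtain ⟨U, hUV, hU, hkU⟩ := mem_nhds_iff.1 hV
    obtain ⟨k', hk'U, hk'⟩ := mem_closure_iff.1 hk U hU hkU
    obtain ⟨p, hp, q, hq, hr⟩ := hk'.2 U (hU.mem_nhds hk'U)
    exact ⟨p, ⟨hUV hp.1, hp.2⟩, q, ⟨hUV hq.1, hq.2⟩, hr⟩

theorem mem_iterDeriv {ζ : Ordinal.{u}} {k : Q} :
    k ∈ iterDeriv r ζ L ↔ k ∈ L ∧ ∀ γ < ζ, k ∈ relDeriv r (iterDeriv r γ L) := by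
  rw [iterDeriv]
  simp

theorem iterDeriv_subset {ζ : Ordinal.{u}} : iterDeriv r ζ L ⊆ L :=
  fun _ h => (mem_iterDeriv.1 h).1

@[simp] theorem iterDeriv_zero : iterDeriv r (0 : Ordinal.{u}) L = L := by
  ext k
  simp [mem_iterDeriv]

theorem iterDeriv_anti {ζ η : Ordinal.{u}} (h : ζ ≤ η) : iterDeriv r η L ⊆ iterDeriv r ζ L := by
  intro k hk
  rw [mem_iterDeriv] at *
  exact ⟨hk.1, fun γ hγ => hk.2 γ (hγ.trans_le h)⟩

theorem iterDeriv_add_one {ζ : Ordinal.{u}} :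
    iterDeriv r (ζ + 1) L = relDeriv r (iterDeriv r ζ L) := by
  ext k
  rw [mem_iterDeriv]
  constructor
  · exact fun h => h.2 ζ (Order.lt_add_one_iff.2 le_rfl)
  · refine fun h => ⟨iterDeriv_subset (relDeriv_subset h), fun γ hγ => ?_⟩
    exact relDeriv_mono (iterDeriv_anti (Order.lt_add_one_iff.1 hγ)) h

theorem iterDeriv_mono {ζ : Ordinal.{u}} (h : L ⊆ L') : iterDeriv r ζ L ⊆ iterDeriv r ζ L' := by
  induction ζ using WellFoundedLT.induction with | _ ζ ih =>
  intro k hk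
  rw [mem_iterDeriv] at *
  exact ⟨h hk.1, fun γ hγ => relDeriv_mono (ih γ hγ) (hk.2 γ hγ)⟩

theorem isClosed_iterDeriv {ζ : Ordinal.{u}} (hL : IsClosed L) : IsClosed (iterDeriv r ζ L) := by
  induction ζ using WellFoundedLT.induction with | _ ζ ih =>
  rw [iterDeriv]
  exact hL.inter (isClosed_iInter fun γ => isClosed_relDeriv (ih γ.1 γ.2))

theorem iterDeriv_add {a b : Ordinal.{u}} :
    iterDeriv r (a + b) L ⊆ iterDeriv r b (iterDeriv r a L) ∧
      iterDeriv r b (iterDeriv r a L) ⊆ iterDeriv r (a + b) L := by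
  induction b using WellFoundedLT.induction with | _ b ih =>
  constructor
  · intro k hk
    refine mem_iterDeriv.2 ⟨iterDeriv_anti le_self_add hk, fun γ hγ => ?_⟩
    have := (mem_iterDeriv.1 hk).2 (a + γ) (by gcongr)
    exact relDeriv_mono (ih γ hγ).1 this
  · intro k hk
    have hka := iterDeriv_subset hk
    refine mem_iterDeriv.2 ⟨iterDeriv_subset hka, fun γ hγ => ?_⟩
    rcases lt_or_ge γ a with h | h
    · exact (mem_iterDeriv.1 hka).2 γ h
    · obtain ⟨c, rfl⟩ := exists_add_of_le h
      have hc : c < b := (add_lt_add_iff_left _).1 hγ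
      exact relDeriv_mono (ih c hc).2 ((mem_iterDeriv.1 hk).2 c hc)

/-- A point outside the `ζ`-th iterate leaves the iterates at a successor step. -/
theorem exists_notMem_iterDeriv_add_one {ζ : Ordinal.{u}} {k : Q} (hkL : k ∈ L)
    (hk : k ∉ iterDeriv r ζ L) : ∃ γ < ζ, k ∉ iterDeriv r (γ + 1) L := by
  simp only [iterDeriv_add_one]
  rw [mem_iterDeriv] at hk
  push Not at hk
  exact hk hkL

/-- Decreasing nonempty closed sets in a compact space have a common point, so the iterates cannot
first vanish at a limit. -/
theorem exists_iterDeriv_add_one_eq_empty [CompactSpace Q] {ζ : Ordinal.{u}} (hL : IsClosed L)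
    (hne : ζ ≠ 0) (h : iterDeriv r ζ L = ∅) : ∃ γ < ζ, iterDeriv r (γ + 1) L = ∅ := by
  have : Nonempty (Set.Iio ζ) := ⟨⟨0, pos_iff_ne_zero.2 hne⟩⟩
  by_contra! hcon
  have key : (⋂ γ : Set.Iio ζ, iterDeriv r (γ.1 + 1) L).Nonempty := by
    refine IsCompact.nonempty_iInter_of_directed_nonempty_isCompact_isClosed _ ?_
      (fun γ => hcon γ.1 γ.2) (fun γ => (isClosed_iterDeriv hL).isCompact)
      (fun γ => isClosed_iterDeriv hL)
    refine Antitone.directed_ge fun a b hab => iterDeriv_anti ?_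
    gcongr
  obtain ⟨k, hk⟩ := key
  rw [Set.mem_iInter] at hk
  have : k ∈ iterDeriv r ζ L := mem_iterDeriv.2
    ⟨iterDeriv_subset (hk (Classical.arbitrary _)), fun γ hγ => by
      rw [← iterDeriv_add_one]; exact hk ⟨γ, hγ⟩⟩
  rw [h] at this
  exact this

end Derivation

/-! ### Derivations on products -/

section Product

universe v w
variable {Q₀ : Type v} {Q₁ : Type w} [TopologicalSpace Q₀] [TopologicalSpace Q₁]
  {r : Q₀ × Q₁ → Q₀ × Q₁ → Prop} {r₀ : Q₀ → Q₀ → Prop} {r₁ : Q₁ → Q₁ → Prop}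

theorem exists_nhds_not_rel {Q : Type v} [TopologicalSpace Q] {r : Q → Q → Prop}
    {a : Ordinal.{u}} {y : Q} (hy : y ∉ iterDeriv r (a + 1) Set.univ) :
    ∃ V ∈ 𝓝 y, (∀ p ∈ V ∩ iterDeriv r a Set.univ, ∀ q ∈ V ∩ iterDeriv r a Set.univ, ¬ r p q) ∧
      ∀ p ∈ V, p ∉ iterDeriv r (a + 1) Set.univ := by
  have hopen : (iterDeriv r (a + 1) Set.univ)ᶜ ∈ 𝓝 y :=
    (isClosed_iterDeriv isClosed_univ).isOpen_compl.mem_nhds hy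
  by_cases hya : y ∈ iterDeriv r a Set.univ
  · rw [iterDeriv_add_one] at hy
    have : ∃ V ∈ 𝓝 y, ∀ p ∈ V ∩ iterDeriv r a Set.univ,
        ∀ q ∈ V ∩ iterDeriv r a Set.univ, ¬ r p q := by
      by_contra! hcon
      exact hy ⟨hya, hcon⟩
    obtain ⟨V, hV, h⟩ := this
    exact ⟨V ∩ (iterDeriv r (a + 1) Set.univ)ᶜ, inter_mem hV hopen,
      fun p hp q hq => h p ⟨hp.1.1, hp.2⟩ q ⟨hq.1.1, hq.2⟩, fun p hp => hp.2⟩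
  · refine ⟨(iterDeriv r a Set.univ)ᶜ ∩ (iterDeriv r (a + 1) Set.univ)ᶜ, inter_mem
      ((isClosed_iterDeriv isClosed_univ).isOpen_compl.mem_nhds hya) hopen,
      fun p hp => (hp.1.1 hp.2).elim, fun p hp => hp.2⟩

/-- Near `k`, a point surviving to stage `naturalSum a b` must have coordinates surviving to stages
`a` and `b`: an earlier exit of a coordinate is excluded by induction, as the natural sum is
strictly monotone. Among such points no coordinates are related near `k`, so none of the points are
related by `r`. -/
theorem notMem_iterDeriv_prod {W : Set (Q₀ × Q₁)} (hW : IsOpen W)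
    (hr : ∀ p ∈ W, ∀ q ∈ W, r p q → r₀ p.1 q.1 ∨ r₁ p.2 q.2) (a : Ordinal.{u}) :
    ∀ (b : Ordinal.{u}) (k : Q₀ × Q₁), k ∈ W → k.1 ∉ iterDeriv r₀ (a + 1) Set.univ →
      k.2 ∉ iterDeriv r₁ (b + 1) Set.univ →
      k ∉ iterDeriv r (naturalSum a b + 1) Set.univ := by
  induction a using WellFoundedLT.induction with | _ a iha =>
  intro b
  induction b using WellFoundedLT.induction with | _ b ihb =>
  intro k hkW hk₀ hk₁ hk
  obtain ⟨V₀, hV₀, hd₀, he₀⟩ := exists_nhds_not_rel hk₀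
  obtain ⟨V₁, hV₁, hd₁, he₁⟩ := exists_nhds_not_rel hk₁
  have hV : (V₀ ×ˢ V₁) ∩ W ∈ 𝓝 k := by
    refine inter_mem ?_ (hW.mem_nhds hkW)
    rw [nhds_prod_eq]
    exact prod_mem_prod hV₀ hV₁
  have claim : ∀ p ∈ ((V₀ ×ˢ V₁) ∩ W) ∩ iterDeriv r (naturalSum a b) Set.univ,
      p.1 ∈ iterDeriv r₀ a Set.univ ∧ p.2 ∈ iterDeriv r₁ b Set.univ := by
    rintro p ⟨⟨⟨hp₀, hp₁⟩, hpW⟩, hp⟩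
    constructor
    · by_contra hcon
      obtain ⟨a', ha', hpa'⟩ := exists_notMem_iterDeriv_add_one (Set.mem_univ _) hcon
      exact iha a' ha' b p hpW hpa' (he₁ _ hp₁)
        (iterDeriv_anti (Order.add_one_le_iff.2 (naturalSum_lt_left ha')) hp)
    · by_contra hcon
      obtain ⟨b', hb', hpb'⟩ := exists_notMem_iterDeriv_add_one (Set.mem_univ _) hcon
      exact ihb b' hb' p hpW (he₀ _ hp₀) hpb'
        (iterDeriv_anti (Order.add_one_le_iff.2 (naturalSum_lt_right hb')) hp)
  rw [iterDeriv_add_one] at hk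
  obtain ⟨p, hp, q, hq, hpq⟩ := hk.2 _ hV
  rcases hr p hp.1.2 q hq.1.2 hpq with h | h
  · exact hd₀ p.1 ⟨hp.1.1.1, (claim p hp).1⟩ q.1 ⟨hq.1.1.1, (claim q hq).1⟩ h
  · exact hd₁ p.2 ⟨hp.1.1.2, (claim p hp).2⟩ q.2 ⟨hq.1.1.2, (claim q hq).2⟩ h

/-- If points of `W` related by `r` have a related coordinate, then a point of `W` in the
`ω ^ ξ`-th iterate for `r` has a coordinate in the `ω ^ ξ`-th iterate. -/
theorem mem_iterDeriv_fst_or_snd {W : Set (Q₀ × Q₁)} (hW : IsOpen W)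
    (hr : ∀ p ∈ W, ∀ q ∈ W, r p q → r₀ p.1 q.1 ∨ r₁ p.2 q.2) {ξ : Ordinal.{u}} {k : Q₀ × Q₁}
    (hkW : k ∈ W) (hk : k ∈ iterDeriv r (Ordinal.omega0 ^ ξ) Set.univ) :
    k.1 ∈ iterDeriv r₀ (Ordinal.omega0 ^ ξ) Set.univ ∨
      k.2 ∈ iterDeriv r₁ (Ordinal.omega0 ^ ξ) Set.univ := by
  by_contra! hcon
  obtain ⟨a, ha, hka⟩ := exists_notMem_iterDeriv_add_one (Set.mem_univ _) hcon.1
  obtain ⟨b, hb, hkb⟩ := exists_notMem_iterDeriv_add_one (Set.mem_univ _) hcon.2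
  exact notMem_iterDeriv_prod hW hr a b k hkW hka hkb (iterDeriv_anti
    (Order.add_one_le_iff.2 (naturalSum_lt_omega0_opow ξ a ha b hb)) hk)

end Product

/-! ### Positions in trees -/

section Trees

variable {Λ : Type u} {T : Set (List Λ)}

/-- From the position `l` one can climb `T` along any strictly decreasing sequence of ordinals
below `ζ`. -/
def HasHeight (T : Set (List Λ)) (ζ : Ordinal.{u}) (l : List Λ) : Prop :=
  ∀ γ : Set.Iio ζ, ∃ a, l ++ [a] ∈ T ∧ HasHeight T γ.1 (l ++ [a])
termination_by ζ
decreasing_by exact γ.2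

theorem HasHeight.exists_append {ζ γ : Ordinal.{u}} {l : List Λ} (h : HasHeight T ζ l)
    (hγ : γ < ζ) : ∃ a, l ++ [a] ∈ T ∧ HasHeight T γ (l ++ [a]) := by
  rw [HasHeight] at h
  exact h ⟨γ, hγ⟩

theorem hasHeight_of_forall {ζ : Ordinal.{u}} {l : List Λ}
    (h : ∀ γ < ζ, ∃ a, l ++ [a] ∈ T ∧ HasHeight T γ (l ++ [a])) : HasHeight T ζ l := by
  rw [HasHeight]
  exact fun γ => h γ.1 γ.2

theorem HasHeight.mono {ζ η : Ordinal.{u}} {l : List Λ} (h : HasHeight T ζ l) (hη : η ≤ ζ) :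
    HasHeight T η l :=
  hasHeight_of_forall fun _ hγ => h.exists_append (hγ.trans_le hη)

theorem derivedTree_zero : derivedTree T 0 = T := by
  simp [derivedTree]

theorem derivedTree_add_one (ζ : Ordinal.{u}) :
    derivedTree T (ζ + 1) = derivedTree T ζ \ maxMembers (derivedTree T ζ) := by
  simp [derivedTree]

theorem derivedTree_limit {ζ : Ordinal.{u}} (hζ : Order.IsSuccLimit ζ) :
    derivedTree T ζ = ⋂ (γ) (_ : γ < ζ), derivedTree T γ := by
  simp [derivedTree, hζ]

theorem derivedTree_anti {ζ η : Ordinal.{u}} (h : ζ ≤ η) :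
    derivedTree T η ⊆ derivedTree T ζ := by
  induction η using Ordinal.limitRecOn with
  | zero => rw [le_antisymm h zero_le]
  | add_one η ih =>
    rcases h.lt_or_eq with h | rfl
    · rw [derivedTree_add_one]
      exact Set.sdiff_subset.trans (ih (Order.lt_add_one_iff.1 h))
    · rfl
  | limit η hη ih =>
    rcases h.lt_or_eq with h | rfl
    · rw [derivedTree_limit hη]
      exact Set.iInter₂_subset ζ h
    · rfl

theorem isTree_derivedTree (hT : IsTree T) (ζ : Ordinal.{u}) : IsTree (derivedTree T ζ) := by
  induction ζ using Ordinal.limitRecOn with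
  | zero => rwa [derivedTree_zero]
  | add_one ζ ih =>
    rw [derivedTree_add_one]
    refine ⟨fun h => ih.1 h.1, fun s t hs hst ht => ⟨ih.2 s t hs hst ht.1, fun hmax => ?_⟩⟩
    have := hmax.2 t ht.1 hst
    subst this
    exact ht.2 hmax
  | limit ζ hζ ih =>
    rw [derivedTree_limit hζ]
    constructor
    · intro h
      rw [Set.mem_iInter₂] at h
      exact (ih 0 (by simpa using hζ.bot_lt)).1 (h 0 (by simpa using hζ.bot_lt))
    · intro s t hs hst ht
      rw [Set.mem_iInter₂] at *
      exact fun γ hγ => (ih γ hγ).2 s t hs hst (ht γ hγ)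

theorem hasHeight_of_mem_derivedTree (hT : IsTree T) {ζ : Ordinal.{u}} :
    ∀ {l : List Λ}, l ∈ derivedTree T ζ → HasHeight T ζ l := by
  induction ζ using WellFoundedLT.induction with | _ ζ ih =>
  intro l hl
  refine hasHeight_of_forall fun γ hγ => ?_
  have hl' := derivedTree_anti (Order.add_one_le_iff.2 hγ) hl
  rw [derivedTree_add_one] at hl'
  have : ∃ s ∈ derivedTree T γ, l <+: s ∧ s ≠ l := by
    by_contra! hcon
    exact hl'.2 ⟨hl'.1, hcon⟩
  obtain ⟨s, hs, ⟨m, rfl⟩, hne⟩ := this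
  obtain _ | ⟨a, m⟩ := m
  · simp at hne
  have hla : l ++ [a] ∈ derivedTree T γ :=
    (isTree_derivedTree hT γ).2 _ _ (by simp) ⟨m, by simp⟩ hs
  refine ⟨a, ?_, ih γ hγ hla⟩
  have := derivedTree_anti (zero_le (a := γ)) hla
  rwa [derivedTree_zero] at this

/-- Only the minimality of the order enters: every earlier derived tree is nonempty, hence contains
a sequence of length one. -/
theorem HasOrder.hasHeight_nil (hT : IsTree T) {ζ : Ordinal.{u}} (hζ : HasOrder T ζ) :
    HasHeight T ζ [] := by
  refine hasHeight_of_forall fun γ hγ => ?_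
  have hne : (derivedTree T γ).Nonempty := by
    rw [Set.nonempty_iff_ne_empty]
    exact fun h => (hζ.2 h).not_gt hγ
  obtain ⟨s, hs⟩ := hne
  obtain _ | ⟨a, m⟩ := s
  · exact ((isTree_derivedTree hT γ).1 hs).elim
  have ha : [a] ∈ derivedTree T γ :=
    (isTree_derivedTree hT γ).2 _ _ (by simp) ⟨m, by simp⟩ hs
  refine ⟨a, ?_, hasHeight_of_mem_derivedTree hT ha⟩
  have := derivedTree_anti (zero_le (a := γ)) ha
  rwa [derivedTree_zero] at this

end Trees

/-! ### Small convex combinations along branches -/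

section Averaging

universe v
variable {Λ D : Type u}

/-- The values of `h` on the part of the branch of `t ++ m` that lies beyond `t`. -/
def segmentValues {E : Type v} {M : Type u} (h : List M → E) (t m : List M) : Set E :=
  {F | ∃ s, s ≠ [] ∧ s <+: m ∧ F = h (t ++ s)}

theorem segmentValues_subset_left {E : Type v} {M : Type u} {h : List M → E} {t m m' : List M} :
    segmentValues h t m ⊆ segmentValues h t (m ++ m') := by
  rintro _ ⟨s, hs, hsm, rfl⟩
  exact ⟨s, hs, hsm.trans (List.prefix_append _ _), rfl⟩

theorem segmentValues_subset_right {E : Type v} {M : Type u} {h : List M → E} {t m m' : List M} :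
    segmentValues h (t ++ m) m' ⊆ segmentValues h t (m ++ m') := by
  rintro _ ⟨s, hs, hsm, rfl⟩
  exact ⟨m ++ s, by simp [hs], (List.prefix_append_right_inj _).2 hsm, by simp⟩

theorem treeDot_of_prefix {T : Set (List Λ)} (hT : IsTree T) {s t : List (Λ × D)} (hs : s ≠ [])
    (hst : s <+: t) (ht : t ∈ treeDot T D) : s ∈ treeDot T D :=
  hT.2 _ _ (by simpa using hs) (hst.map _) ht

variable {Q : Type v} [TopologicalSpace Q]

theorem le_of_mem_convexHull_segmentValues {T : Set (List Λ)} (hT : IsTree T)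
    {h : List (Λ × D) → C(Q, ℝ)} {M : ℝ} (hM : ∀ t ∈ treeDot T D, ∀ q, h t q ≤ M)
    {t m : List (Λ × D)} (hm : m = [] ∨ t ++ m ∈ treeDot T D) {F : C(Q, ℝ)}
    (hF : F ∈ convexHull ℝ (segmentValues h t m)) (q : Q) : F q ≤ M := by
  have hconv : Convex ℝ {G : C(Q, ℝ) | G q ≤ M} := by
    intro f hf g hg a b ha hb hab
    have h₁ := mul_le_mul_of_nonneg_left (show f q ≤ M from hf) ha
    have h₂ := mul_le_mul_of_nonneg_left (show g q ≤ M from hg) hb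
    have h₃ : a * M + b * M = M := by rw [← add_mul, hab, one_mul]
    change a * f q + b * g q ≤ M
    linarith
  refine convexHull_min ?_ hconv hF
  rintro _ ⟨s, hs, hsm, rfl⟩
  rcases hm with rfl | hm
  · exact (hs (List.prefix_nil.1 hsm)).elim
  · exact hM _ (treeDot_of_prefix hT (by simp [hs])
      ((List.prefix_append_right_inj _).2 hsm) hm) q

/-- Beyond each position of height `β + p` there are convex combinations of `h` that are small on
any given finite family of closed sets with empty `p`-th iterated derivatives, and lead to a
position of height `β`. -/
def HasSmallAverages (T : Set (List Λ)) (h : List (Λ × D) → C(Q, ℝ)) (r : Q → Q → Prop)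
    (p : Ordinal.{u}) : Prop :=
  ∀ (β : Ordinal.{u}) (t : List (Λ × D)), HasHeight T (β + p) (t.map Prod.fst) →
    ∀ (ι : Type) [Finite ι] (L : ι → Set Q), (∀ i, IsClosed (L i)) →
      (∀ i, iterDeriv r p (L i) = ∅) → ∀ ε > 0, ∃ m : List (Λ × D),
        (m = [] ∨ t ++ m ∈ treeDot T D) ∧ HasHeight T β ((t ++ m).map Prod.fst) ∧
        ∃ F ∈ convexHull ℝ (segmentValues h t m), ∀ i, ∀ q ∈ L i, F q ≤ ε

variable {T : Set (List Λ)} {h : List (Λ × D) → C(Q, ℝ)} {r : Q → Q → Prop}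

/-- A counting argument: at a fixed point of `L i`, at most `n i` of the `N` successive combinations
can exceed `2 * ε`, because each time one does, the point lies in a set that needs one block `p`
fewer to derive to nothing. Each set is split in two at every stage, which is why finite families
are carried along. -/
theorem HasSmallAverages.exists_sum (hT : IsTree T) {p : Ordinal.{u}}
    (hp : HasSmallAverages T h r p) {M : ℝ} (hM₀ : 0 ≤ M)
    (hM : ∀ t ∈ treeDot T D, ∀ q, h t q ≤ M) (N : ℕ) :
    ∀ (β : Ordinal.{u}) (t : List (Λ × D)), HasHeight T (β + p * N) (t.map Prod.fst) →
    ∀ (ι : Type) [Finite ι] (L : ι → Set Q) (n : ι → ℕ), (∀ i, IsClosed (L i)) →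
      (∀ i, iterDeriv r (p * n i) (L i) = ∅) → ∀ ε > 0, ∃ m : List (Λ × D),
        (m = [] ∨ t ++ m ∈ treeDot T D) ∧ HasHeight T β ((t ++ m).map Prod.fst) ∧
        ∃ F : Fin N → C(Q, ℝ), (∀ j, F j ∈ convexHull ℝ (segmentValues h t m)) ∧
          ∀ i, ∀ q ∈ L i, ∑ j, F j q ≤ N * (2 * ε) + n i * M := by
  induction N with
  | zero =>
    intro β t ht ι _ L n hL hn ε hε
    refine ⟨[], Or.inl rfl, by simpa using ht, Fin.elim0, fun j => j.elim0, fun i q hq => ?_⟩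
    simpa using by positivity
  | succ N ih =>
    intro β t ht ι _ L n hL hn ε hε
    have ht' : HasHeight T (β + p * N + p) (t.map Prod.fst) := by
      rwa [Nat.cast_succ, mul_add_one, ← add_assoc] at ht
    have hempty : ∀ i, n i = 0 → L i = ∅ := fun i hi => by simpa [hi] using hn i
    -- The truncated subtraction is harmless: when `n i = 0` the set `L i` is already empty.
    have hL' : ∀ i, iterDeriv r p (iterDeriv r (p * (n i - 1 : ℕ)) (L i)) = ∅ := by
      intro i
      rcases hni : n i with _ | k
      · refine Set.subset_empty_iff.1 (iterDeriv_subset.trans (iterDeriv_subset.trans ?_))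
        rw [hempty i hni]
      · refine Set.subset_empty_iff.1 (iterDeriv_add.2.trans ?_)
        rw [← hn i, hni, Nat.cast_succ, mul_add_one, Nat.add_sub_cancel]
    obtain ⟨m₁, hm₁, hh₁, F₁, hF₁, hle₁⟩ := hp _ t ht' ι _
      (fun i => isClosed_iterDeriv (hL i)) hL' ε hε
    -- Since `F₁ ≤ ε` on the `p * (n i - 1)`-th derivative, the part of `L i` where `F₁ ≥ 2 * ε` has
    -- that derivative empty, so its count drops by one; the other part keeps its count.
    obtain ⟨m₂, hm₂, hh₂, F, hF, hle⟩ := ih β (t ++ m₁) hh₁ (ι × Bool)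
      (fun x => L x.1 ∩ {q | bif x.2 then 2 * ε ≤ F₁ q else F₁ q ≤ 2 * ε})
      (fun x => bif x.2 then n x.1 - 1 else n x.1) (by
        rintro ⟨i, _ | _⟩
        · exact (hL i).inter (isClosed_le F₁.continuous continuous_const)
        · exact (hL i).inter (isClosed_le continuous_const F₁.continuous)) (by
        rintro ⟨i, _ | _⟩
        · refine Set.subset_empty_iff.1 ((iterDeriv_mono Set.inter_subset_left).trans ?_)
          rw [← hn i]
          rfl
        · refine Set.subset_empty_iff.1 fun q hq => ?_
          have h₁ := hle₁ i q (iterDeriv_mono Set.inter_subset_left hq)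
          have h₂ : 2 * ε ≤ F₁ q := (iterDeriv_subset hq).2
          linarith) ε hε
    refine ⟨m₁ ++ m₂, ?_, by rwa [← List.append_assoc], Fin.cons F₁ F, ?_, ?_⟩
    · rcases hm₂ with rfl | hm₂
      · simpa using hm₁
      · exact Or.inr (by rwa [← List.append_assoc])
    · intro j
      refine Fin.cases ?_ (fun j => ?_) j
      · exact convexHull_mono segmentValues_subset_left hF₁
      · exact convexHull_mono segmentValues_subset_right (hF j)
    · intro i q hq
      rw [Fin.sum_univ_succ]
      simp only [Fin.cons_zero, Fin.cons_succ]
      have hni : n i ≠ 0 := fun h0 => by simp [hempty i h0] at hq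
      push_cast
      rcases le_total (F₁ q) (2 * ε) with hF₁q | hF₁q
      · have := hle (i, false) q ⟨hq, hF₁q⟩
        simp only [cond_false] at this
        linarith
      · have h₁ := hle (i, true) q ⟨hq, hF₁q⟩
        have h₂ := le_of_mem_convexHull_segmentValues hT hM hm₁ hF₁ q
        simp only [cond_true] at h₁
        rw [Nat.cast_sub (Nat.one_le_iff_ne_zero.2 hni), Nat.cast_one] at h₁
        linarith

variable [Preorder D] [IsDirected D (· ≤ ·)] [Nonempty D] [CompactSpace Q]

/-- For `ω ^ 0 = 1`, one step far enough along `D` works. At a successor, compactness bounds by a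
fixed `n₀` the number of large terms at each point, so averaging `N` combinations dilutes them. At a
limit, compactness and finiteness of the family reduce to a smaller power. -/
theorem hasSmallAverages_omega0_opow (hT : IsTree T) {M : ℝ} (hM₀ : 0 ≤ M)
    (hM : ∀ t ∈ treeDot T D, ∀ q, h t q ≤ M)
    (hnull : ∀ (t : List (Λ × D)) (a : Λ), (∀ u : D, t ++ [(a, u)] ∈ treeDot T D) →
      ∀ L : Set Q, IsClosed L → relDeriv r L = ∅ → ∀ ε > 0,
        ∀ᶠ u : D in atTop, ∀ q ∈ L, h (t ++ [(a, u)]) q ≤ ε) (ξ : Ordinal.{u}) :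
    HasSmallAverages T h r (Ordinal.omega0 ^ ξ) := by
  induction ξ using Ordinal.limitRecOn with
  | zero =>
    intro β t ht ι _ L hL hd ε hε
    rw [Ordinal.opow_zero] at ht hd
    obtain ⟨a, ha, hha⟩ := ht.exists_append (Order.lt_add_one_iff.2 le_rfl)
    have hmem : ∀ u : D, t ++ [(a, u)] ∈ treeDot T D := fun u => by simpa [treeDot] using ha
    have hd' : ∀ i, relDeriv r (L i) = ∅ := fun i => by
      have := hd i
      rwa [← zero_add (1 : Ordinal.{u}), iterDeriv_add_one, iterDeriv_zero] at this
    obtain ⟨u, hu⟩ := (eventually_all.2 fun i => hnull t a hmem (L i) (hL i) (hd' i) ε hε).exists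
    refine ⟨[(a, u)], Or.inr (hmem u), by simpa using hha, h (t ++ [(a, u)]),
      subset_convexHull _ _ ⟨_, by simp, List.prefix_refl _, rfl⟩, hu⟩
  | add_one ξ ih =>
    intro β t ht ι _ L hL hd ε hε
    have hn : ∀ i, ∃ n : ℕ, iterDeriv r (Ordinal.omega0 ^ ξ * n) (L i) = ∅ := by
      intro i
      obtain ⟨γ, hγ, hγL⟩ := exists_iterDeriv_add_one_eq_empty (hL i)
        (Ordinal.opow_ne_zero _ Ordinal.omega0_ne_zero) (hd i)
      obtain ⟨n, s, hs, rfl⟩ := exists_nat_of_lt_opow_succ hγ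
      refine ⟨n + 1, Set.subset_empty_iff.1 (hγL ▸ iterDeriv_anti ?_)⟩
      exact Order.add_one_le_iff.2 (by
        simpa using mul_add_lt_mul hs (Nat.lt_succ_self n))
    choose n hn using hn
    obtain ⟨n₀, hn₀⟩ := Finite.exists_le n
    -- With `ε / 4` in each combination the small terms contribute at most `N * ε / 2`, and this `N`
    -- makes the large ones contribute less than `N * ε / 2`.
    obtain ⟨N, hN⟩ := exists_nat_gt (2 * (n₀ * M) / ε)
    have hNpos : (0 : ℝ) < N := lt_of_le_of_lt (by positivity) hN
    have hht : HasHeight T (β + Ordinal.omega0 ^ ξ * N) (t.map Prod.fst) := by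
      refine ht.mono ?_
      rw [Ordinal.opow_add_one]
      gcongr
      exact (Ordinal.natCast_lt_omega0 _).le
    obtain ⟨m, hm, hh, F, hF, hle⟩ := ih.exists_sum hT hM₀ hM N β t hht ι L n hL hn (ε / 4)
      (by positivity)
    refine ⟨m, hm, hh, ∑ j, (1 / N : ℝ) • F j, (convex_convexHull ℝ _).sum_mem
      (fun _ _ => by positivity) (by simp [hNpos.ne']) (fun j _ => hF j), fun i q hq => ?_⟩
    have h₁ := hle i q hq
    have h₂ : (n i : ℝ) * M ≤ n₀ * M := by
      gcongr
      exact hn₀ i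
    rw [div_lt_iff₀ hε] at hN
    have h₃ : (∑ j, (1 / N : ℝ) • F j) q = (∑ j, F j q) / N := by
      rw [ContinuousMap.sum_apply, Finset.sum_div]
      exact Finset.sum_congr rfl fun j _ => by
        rw [ContinuousMap.smul_apply, smul_eq_mul, one_div_mul_eq_div]
    rw [h₃, div_le_iff₀ hNpos]
    linarith
  | limit ξ hξ ih =>
    intro β t ht ι _ L hL hd ε hε
    have hγ : ∀ i, ∃ γ : Set.Iio ξ, iterDeriv r (Ordinal.omega0 ^ γ.1) (L i) = ∅ := by
      intro i
      obtain ⟨γ, hγ, hγL⟩ := exists_iterDeriv_add_one_eq_empty (hL i)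
        (Ordinal.opow_ne_zero _ Ordinal.omega0_ne_zero) (hd i)
      obtain ⟨c, hc, hγc⟩ := (Ordinal.lt_opow_of_isSuccLimit Ordinal.omega0_ne_zero hξ).1 hγ
      exact ⟨⟨c, hc⟩, Set.subset_empty_iff.1
        (hγL ▸ iterDeriv_anti (Order.add_one_le_iff.2 hγc))⟩
    choose γ hγ using hγ
    have : Nonempty (Set.Iio ξ) := ⟨⟨0, by simpa using hξ.bot_lt⟩⟩
    obtain ⟨c, hc⟩ := Finite.exists_le γ
    refine ih c.1 c.2 β t (ht.mono ?_) ι L hL (fun i => ?_) ε hε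
    · gcongr
      · exact Ordinal.omega0_pos
      · exact (show c.1 < ξ from c.2).le
    · refine Set.subset_empty_iff.1 (hγ i ▸ iterDeriv_anti ?_)
      exact Ordinal.opow_le_opow_right Ordinal.omega0_pos (hc i)

/-- If the `ω ^ ξ`-th iterated derivative of a compact space is empty, then some convex
combination along a branch of a tree of order `ω ^ ξ` is uniformly small. -/
theorem exists_small_convex_combination (hT : IsTree T) {ξ : Ordinal.{u}}
    (hξ : HasOrder T (Ordinal.omega0 ^ ξ)) {M : ℝ} (hM₀ : 0 ≤ M)
    (hM : ∀ t ∈ treeDot T D, ∀ q, h t q ≤ M)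
    (hnull : ∀ (t : List (Λ × D)) (a : Λ), (∀ u : D, t ++ [(a, u)] ∈ treeDot T D) →
      ∀ L : Set Q, IsClosed L → relDeriv r L = ∅ → ∀ ε > 0,
        ∀ᶠ u : D in atTop, ∀ q ∈ L, h (t ++ [(a, u)]) q ≤ ε)
    (hr : iterDeriv r (Ordinal.omega0 ^ ξ) (Set.univ : Set Q) = ∅) {ε : ℝ} (hε : 0 < ε) :
    ∃ t ∈ treeDot T D, ∃ a : ℕ → ℝ, (∀ i < t.length, 0 ≤ a i) ∧
      ∑ i ∈ Finset.range t.length, a i = 1 ∧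
      ∀ q, ∑ i ∈ Finset.range t.length, a i * h (t.take (i + 1)) q ≤ ε := by
  obtain ⟨t, ht, -, F, hF, hle⟩ := hasSmallAverages_omega0_opow hT hM₀ hM hnull ξ 0 []
    (by simpa using hξ.hasHeight_nil hT) Unit (fun _ => Set.univ) (fun _ => isClosed_univ)
    (fun _ => hr) ε hε
  have hne : (segmentValues h [] t).Nonempty := convexHull_nonempty_iff.1 ⟨F, hF⟩
  have htT : t ∈ treeDot T D := by
    rcases ht with rfl | ht
    · obtain ⟨_, s, hs, hst, -⟩ := hne
      exact (hs (List.prefix_nil.1 hst)).elim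
    · simpa using ht
  have hset : segmentValues h [] t = Set.range fun i : Fin t.length => h (t.take (i + 1)) := by
    ext G
    constructor
    · rintro ⟨s, hs, hst, rfl⟩
      have hlen := List.length_pos_iff.2 hs
      have hle := hst.length_le
      refine ⟨⟨s.length - 1, by lia⟩, ?_⟩
      simp only [List.nil_append]
      rw [Nat.sub_add_cancel hlen, ← List.prefix_iff_eq_take.1 hst]
    · rintro ⟨i, rfl⟩
      refine ⟨t.take (i + 1), ?_, List.take_prefix _ _, by simp⟩
      have := i.2
      rw [← List.length_pos_iff, List.length_take]
      lia
  rw [hset, convexHull_range_eq_exists_affineCombination] at hF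
  obtain ⟨S, w, hw, hw₁, hwF⟩ := hF
  rw [S.affineCombination_eq_linear_combination _ _ hw₁] at hwF
  classical
  -- The weights `w` are controlled only on the support `S`, so they are replaced by `0` elsewhere.
  refine ⟨t, htT, fun i => if hi : i < t.length then (if ⟨i, hi⟩ ∈ S then w ⟨i, hi⟩ else 0) else 0,
    fun i hi => ?_, ?_, fun q => ?_⟩
  · beta_reduce
    rw [dif_pos hi]
    split_ifs with hiS
    · exact hw _ hiS
    · exact le_rfl
  · rw [Finset.sum_range, ← hw₁]
    simp
  · refine le_of_eq_of_le ?_ (hle () q (Set.mem_univ _))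
    rw [Finset.sum_range, ← hwF, ContinuousMap.sum_apply]
    simp

end Averaging

/-! ### The tree of strictly decreasing sequences of ordinals -/

section DescendingTree

/-- The tree of nonempty strictly decreasing sequences of ordinals below `o`. -/
def descendingTree (o : Ordinal.{u}) : Set (List o.ToType) :=
  {l | l ≠ [] ∧ l.Pairwise (· > ·)}

variable {o : Ordinal.{u}}

theorem isTree_descendingTree : IsTree (descendingTree o) :=
  ⟨fun h => h.1 rfl, fun _ _ hs hst ht => ⟨hs, ht.2.sublist hst.sublist⟩⟩

/-- If all entries exceed `γ`, then `γ` itself can be appended, so the sequence is not maximal at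
stage `γ`; if `γ` is an entry, any further entry would be smaller than `γ`. -/
theorem derivedTree_descendingTree (γ : Ordinal.{u}) :
    derivedTree (descendingTree o) γ =
      {l | l ∈ descendingTree o ∧ ∀ a ∈ l, γ ≤ (a.toOrd : Ordinal.{u})} := by
  induction γ using Ordinal.limitRecOn with
  | zero => simp [derivedTree_zero]
  | add_one γ ih =>
    rw [derivedTree_add_one, ih]
    ext l
    constructor
    · rintro ⟨⟨hl, hlγ⟩, hmax⟩
      refine ⟨hl, fun a ha => Order.add_one_le_iff.2 ((hlγ a ha).lt_of_ne fun hγa => hmax ?_)⟩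
      refine ⟨⟨hl, hlγ⟩, ?_⟩
      rintro _ hs ⟨m, rfl⟩
      obtain _ | ⟨b, m⟩ := m
      · simp
      · have hba : b < a := (List.pairwise_append.1 hs.1.2).2.2 a ha b (by simp)
        have hγb := hs.2 b (by simp)
        rw [hγa] at hγb
        exact absurd (Ordinal.ToType.mk.symm.strictMono hba) hγb.not_gt
    · rintro ⟨hl, hlγ⟩
      have hlγ' : ∀ a ∈ l, γ < (a.toOrd : Ordinal.{u}) :=
        fun a ha => Order.add_one_le_iff.1 (hlγ a ha)
      refine ⟨⟨hl, fun a ha => (hlγ' a ha).le⟩, fun hmax => ?_⟩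
      obtain ⟨a, ha⟩ := List.exists_mem_of_ne_nil l hl.1
      have hγo : γ < o := (hlγ' a ha).trans (show (a.toOrd : Ordinal.{u}) < o from a.toOrd.2)
      let c : o.ToType := Ordinal.ToType.mk ⟨γ, hγo⟩
      have hc : (c.toOrd : Ordinal.{u}) = γ := by simp [c]
      have hs : l ++ [c] ∈ {l | l ∈ descendingTree o ∧ ∀ a ∈ l, γ ≤ (a.toOrd : Ordinal.{u})} := by
        refine ⟨⟨by simp, List.pairwise_append.2 ⟨hl.2, by simp, fun b hb d hd => ?_⟩⟩,
          fun b hb => ?_⟩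
        · rw [List.mem_singleton.1 hd]
          refine Ordinal.ToType.mk.symm.lt_iff_lt.1 ?_
          change (c.toOrd : Ordinal.{u}) < b.toOrd
          rw [hc]
          exact hlγ' b hb
        · rcases List.mem_append.1 hb with hb | hb
          · exact (hlγ' b hb).le
          · rw [List.mem_singleton.1 hb, hc]
      have := hmax.2 _ hs (List.prefix_append _ _)
      simp at this
  | limit γ hγ ih =>
    rw [derivedTree_limit hγ]
    ext l
    simp only [Set.mem_iInter]
    constructor
    · intro h
      have h' : ∀ i < γ, l ∈ descendingTree o ∧ ∀ a ∈ l, i ≤ (a.toOrd : Ordinal.{u}) := by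
        intro i hi
        have := h i hi
        rwa [ih i hi] at this
      exact ⟨(h' 0 (by simpa using hγ.bot_lt)).1, fun a ha =>
        hγ.isSuccPrelimit.le_iff_forall_le.2 fun i hi => (h' i hi).2 a ha⟩
    · intro h i hi
      rw [ih i hi]
      exact ⟨h.1, fun a ha => hi.le.trans (h.2 a ha)⟩

theorem hasOrder_descendingTree : HasOrder (descendingTree o) o := by
  constructor
  · change derivedTree (descendingTree o) o = ∅
    rw [derivedTree_descendingTree, Set.eq_empty_iff_forall_notMem]
    rintro l ⟨hl, hlo⟩
    obtain ⟨a, ha⟩ := List.exists_mem_of_ne_nil l hl.1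
    exact (hlo a ha).not_gt a.toOrd.2
  · intro γ hγ
    by_contra! hγo
    change derivedTree (descendingTree o) γ = ∅ at hγ
    rw [derivedTree_descendingTree] at hγ
    refine Set.notMem_empty [Ordinal.ToType.mk ⟨γ, hγo⟩] (hγ ▸ ⟨⟨by simp, by simp⟩, ?_⟩)
    intro a ha
    rw [List.mem_singleton.1 ha]
    simp

end DescendingTree

/-! ### Weak* null collections from iterated derivatives of the dual ball -/

section DualBall

variable {𝕜 : Type} [RCLike 𝕜]
variable {X : Type u} [NormedAddCommGroup X] [NormedSpace 𝕜 X]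
variable {Y : Type u} [NormedAddCommGroup Y] [NormedSpace 𝕜 Y]

/-- The closed unit ball of the dual of `Y` with the weak* topology. -/
abbrev DualBall (𝕜 : Type) [RCLike 𝕜] (Y : Type u) [NormedAddCommGroup Y] [NormedSpace 𝕜 Y] :
    Type u :=
  {f : WeakDual 𝕜 Y // f ∈ WeakDual.toStrongDual ⁻¹' Metric.closedBall (0 : Y →L[𝕜] 𝕜) 1}

instance : CompactSpace (DualBall 𝕜 Y) :=
  isCompact_iff_compactSpace.1 (WeakDual.isCompact_closedBall 0 1)

/-- The functional underlying a point of the dual ball. -/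
noncomputable def DualBall.toDual (p : DualBall 𝕜 Y) : Y →L[𝕜] 𝕜 := WeakDual.toStrongDual p.1

theorem DualBall.norm_toDual_le (p : DualBall 𝕜 Y) : ‖p.toDual‖ ≤ 1 :=
  mem_closedBall_zero_iff.1 p.2

theorem DualBall.continuous_eval (y : Y) : Continuous fun p : DualBall 𝕜 Y => p.toDual y :=
  (WeakDual.eval_continuous y).comp continuous_subtype_val

/-- A functional of norm at most one as a point of the dual ball. -/
noncomputable def DualBall.ofDual (f : Y →L[𝕜] 𝕜) (hf : ‖f‖ ≤ 1) : DualBall 𝕜 Y :=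
  ⟨StrongDual.toWeakDual f, by simpa using hf⟩

theorem DualBall.toDual_ofDual (f : Y →L[𝕜] 𝕜) (hf : ‖f‖ ≤ 1) :
    (DualBall.ofDual f hf).toDual = f := rfl

/-- Two functionals are related when their images under the adjoint of `A` have distance at
least `ρ`. -/
def FarApart (A : X →L[𝕜] Y) (ρ : ℝ) (p q : DualBall 𝕜 Y) : Prop :=
  ρ ≤ ‖(p.toDual - q.toDual).comp A‖

/-- Of two points at adjoint distance at least `ρ`, one is at distance at least `ρ / 2` from `p`, by
the triangle inequality. -/
theorem exists_far_of_mem_relDeriv {A : X →L[𝕜] Y} {ρ : ℝ} {L : Set (DualBall 𝕜 Y)}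
    {p : DualBall 𝕜 Y} (hp : p ∈ relDeriv (FarApart A ρ) L) (F : Finset Y) (n : ℕ) :
    ∃ q ∈ L, (∀ y ∈ F, ‖q.toDual y - p.toDual y‖ < 1 / (n + 1)) ∧
      ρ / 2 ≤ ‖(q.toDual - p.toDual).comp A‖ := by
  have hV : {q : DualBall 𝕜 Y | ∀ y ∈ F, ‖q.toDual y - p.toDual y‖ < 1 / (n + 1)} ∈ 𝓝 p := by
    refine (F.eventually_all).2 fun y _ => ?_
    have h : Continuous fun q : DualBall 𝕜 Y => ‖q.toDual y - p.toDual y‖ :=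
      ((DualBall.continuous_eval y).sub continuous_const).norm
    refine h.continuousAt.eventually_lt continuousAt_const ?_
    rw [sub_self, norm_zero]
    positivity
  obtain ⟨q, hq, q', hq', hqq'⟩ := hp.2 _ hV
  by_contra! hcon
  have h₁ := hcon q hq.2 hq.1
  have h₂ := hcon q' hq'.2 hq'.1
  have h₃ : (q.toDual - q'.toDual).comp A =
      (q.toDual - p.toDual).comp A - (q'.toDual - p.toDual).comp A := by
    ext x
    simp
  have h₄ : ρ ≤ ‖(q.toDual - q'.toDual).comp A‖ := hqq'
  rw [h₃] at h₄
  have h₅ := norm_sub_le ((q.toDual - p.toDual).comp A) ((q'.toDual - p.toDual).comp A)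
  linarith

/-- The points `q` of the `a`-th iterated derivative that are weak* close to `p` but far from it
under the adjoint of `A`. -/
def IsStep (A : X →L[𝕜] Y) (ρ : ℝ) (p : DualBall 𝕜 Y) (a : Ordinal.{u}) (v : Finset Y × ℕ)
    (q : DualBall 𝕜 Y) : Prop :=
  q ∈ iterDeriv (FarApart A ρ) a Set.univ ∧
    (∀ y ∈ v.1, ‖q.toDual y - p.toDual y‖ < 1 / (v.2 + 1)) ∧
    ρ / 2 ≤ ‖(q.toDual - p.toDual).comp A‖

open Classical in
/-- A point as in `IsStep`, if there is one. -/
noncomputable def step (A : X →L[𝕜] Y) (ρ : ℝ) {o : Ordinal.{u}} (p : DualBall 𝕜 Y)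
    (z : o.ToType × (Finset Y × ℕ)) : DualBall 𝕜 Y :=
  if h : ∃ q, IsStep A ρ p z.1.toOrd z.2 q then h.choose else p

/-- The point reached from `p` by the steps in `t`. -/
noncomputable def walk (A : X →L[𝕜] Y) (ρ : ℝ) {o : Ordinal.{u}} (p : DualBall 𝕜 Y)
    (t : List (o.ToType × (Finset Y × ℕ))) : DualBall 𝕜 Y :=
  t.foldl (step A ρ) p

section Walk

variable {A : X →L[𝕜] Y} {ρ : ℝ} {o : Ordinal.{u}} {p : DualBall 𝕜 Y}

theorem walk_append_singleton (t : List (o.ToType × (Finset Y × ℕ)))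
    (z : o.ToType × (Finset Y × ℕ)) :
    walk A ρ p (t ++ [z]) = step A ρ (walk A ρ p t) z := by
  simp [walk]

theorem isStep_step {z : o.ToType × (Finset Y × ℕ)}
    (hp : p ∈ iterDeriv (FarApart A ρ) ((z.1.toOrd : Ordinal.{u}) + 1) Set.univ) :
    IsStep A ρ p z.1.toOrd z.2 (step A ρ p z) := by
  rw [iterDeriv_add_one] at hp
  have h : ∃ q, IsStep A ρ p z.1.toOrd z.2 q :=
    exists_far_of_mem_relDeriv hp z.2.1 z.2.2
  rw [step, dif_pos h]
  exact h.choose_spec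

/-- A step labelled `a` starts in stage `a + 1` and ends in stage `a`, which contains enough for any
later, strictly smaller label. -/
theorem walk_mem_iterDeriv (hp : p ∈ iterDeriv (FarApart A ρ) o Set.univ)
    (t : List (o.ToType × (Finset Y × ℕ))) (ht : (t.map Prod.fst).Pairwise (· > ·)) :
    ∀ γ < o, (∀ a ∈ t.map Prod.fst, γ < (a.toOrd : Ordinal.{u})) →
      walk A ρ p t ∈ iterDeriv (FarApart A ρ) (γ + 1) Set.univ := by
  induction t using List.reverseRecOn with
  | nil => exact fun γ hγ _ => iterDeriv_anti (Order.add_one_le_iff.2 hγ) hp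
  | append_singleton t z ih =>
    intro γ _ hγ
    rw [List.map_append] at ht hγ
    rw [List.pairwise_append] at ht
    have h := ih ht.1 z.1.toOrd z.1.toOrd.2 fun a ha =>
      Ordinal.ToType.mk.symm.strictMono (ht.2.2 a ha z.1 (by simp))
    rw [walk_append_singleton]
    exact iterDeriv_anti (Order.add_one_le_iff.2 (hγ z.1 (by simp))) (isStep_step h).1

theorem isStep_walk (hp : p ∈ iterDeriv (FarApart A ρ) o Set.univ)
    {t : List (o.ToType × (Finset Y × ℕ))} {z : o.ToType × (Finset Y × ℕ)}
    (ht : t ++ [z] ∈ treeDot (descendingTree o) (Finset Y × ℕ)) :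
    IsStep A ρ (walk A ρ p t) z.1.toOrd z.2 (walk A ρ p (t ++ [z])) := by
  have ht' : ((t ++ [z]).map Prod.fst).Pairwise (· > ·) := ht.2
  rw [List.map_append, List.pairwise_append] at ht'
  rw [walk_append_singleton]
  exact isStep_step (walk_mem_iterDeriv hp t ht'.1 _ z.1.toOrd.2 fun a ha =>
    Ordinal.ToType.mk.symm.strictMono (ht'.2.2 a ha z.1 (by simp)))

end Walk

/-- The modulus starts from a unit functional, whereas `p` may be shorter or zero; for `f = 0`, the
condition `A ≠ 0` ensures that the dual of `Y` has unit vectors. -/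
theorem exists_unit_functional {A : X →L[𝕜] Y} (hA : A ≠ 0) (f : Y →L[𝕜] 𝕜) :
    ∃ e : Y →L[𝕜] 𝕜, ‖e‖ = 1 ∧ f = (‖f‖ : 𝕜) • e := by
  rcases eq_or_ne f 0 with rfl | hf
  · obtain ⟨x, hx⟩ : ∃ x, A x ≠ 0 := by
      by_contra! h
      exact hA (ContinuousLinearMap.ext h)
    obtain ⟨e, he, -⟩ := exists_dual_vector 𝕜 (A x) (norm_ne_zero_iff.2 hx)
    exact ⟨e, he, by simp⟩
  · have hf' : (‖f‖ : 𝕜) ≠ 0 := by simpa using hf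
    refine ⟨(‖f‖ : 𝕜)⁻¹ • f, ?_, by rw [smul_smul, mul_inv_cancel₀ hf', one_smul]⟩
    rw [norm_smul, norm_inv, RCLike.norm_ofReal, abs_norm, inv_mul_cancel₀ (norm_ne_zero_iff.2 hf)]

/-- A point of the `ω ^ ξ`-th iterated derivative of the dual ball bounds the convexity modulus. -/
theorem convexityModulus_le {A : X →L[𝕜] Y} (hA : A ≠ 0) {ξ : Ordinal.{u}} {ρ θ τ : ℝ}
    (hθ₀ : 0 ≤ θ) (hθ₁ : θ ≤ 1) (hτ : τ ≤ θ * (ρ / 2)) {p : DualBall 𝕜 Y}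
    (hp : p ∈ iterDeriv (FarApart A ρ) (Ordinal.omega0 ^ ξ) Set.univ) :
    convexityModulus ξ τ A ≤ ((θ * (1 - ‖p.toDual‖) : ℝ) : EReal) := by
  classical
  obtain ⟨e, he, hpe⟩ := exists_unit_functional hA p.toDual
  set o : Ordinal.{u} := Ordinal.omega0 ^ ξ with ho
  -- Scaled increments of the walk, so that branch sums telescope.
  let w : List (o.ToType × (Finset Y × ℕ)) → (Y →L[𝕜] 𝕜) := fun t =>
    (θ : 𝕜) • ((walk A ρ p t).toDual - (walk A ρ p t.dropLast).toDual)
  have hw : ∀ t z, w (t ++ [z]) =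
      (θ : 𝕜) • ((walk A ρ p (t ++ [z])).toDual - (walk A ρ p t).toDual) := by
    intro t z
    simp [w]
  have hsum : ∀ t, branchSum w t = (θ : 𝕜) • ((walk A ρ p t).toDual - p.toDual) := by
    intro t
    have h₁ : ∀ i ∈ Finset.range t.length, w (t.take (i + 1)) =
        (θ : 𝕜) • (walk A ρ p (t.take (i + 1))).toDual -
          (θ : 𝕜) • (walk A ρ p (t.take i)).toDual := by
      intro i hi
      rw [Finset.mem_range] at hi
      have h₂ : (t.take (i + 1)).dropLast = t.take i := by
        rw [List.dropLast_eq_take, List.length_take, List.take_take]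
        congr 1
        lia
      simp only [w, h₂, smul_sub]
    rw [branchSum, Finset.sum_congr rfl h₁,
      Finset.sum_range_sub (fun i => (θ : 𝕜) • (walk A ρ p (t.take i)).toDual)]
    simp [walk, smul_sub]
  refine sInf_le_of_le ⟨o.ToType, Finset Y × ℕ, PartialOrder.toPreorder, inferInstance, inferInstance,
    descendingTree o, e, w, isTree_descendingTree, hasOrder_descendingTree, he, ?_, ?_, rfl⟩ ?_
  · intro t a hta y
    rw [Metric.tendsto_atTop]
    intro ε hε
    obtain ⟨n, hn⟩ := exists_nat_one_div_lt hε
    refine ⟨({y}, n), fun v hv => ?_⟩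
    have hstep := (isStep_walk hp (hta v)).2.1 y (hv.1 (by simp))
    rw [dist_zero_right, hw, smul_apply, norm_smul, RCLike.norm_ofReal,
      abs_of_nonneg hθ₀]
    calc θ * ‖((walk A ρ p (t ++ [(a, v)])).toDual - (walk A ρ p t).toDual) y‖
        ≤ 1 * ‖((walk A ρ p (t ++ [(a, v)])).toDual - (walk A ρ p t).toDual) y‖ := by gcongr
      _ < 1 / (v.2 + 1) := by simpa using hstep
      _ ≤ 1 / (n + 1) := by
        gcongr
        exact hv.2
      _ < ε := hn
  · intro t ht
    obtain rfl | ⟨t, z, rfl⟩ := List.eq_nil_or_concat' t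
    · exact (ht.1 rfl).elim
    · have hstep := (isStep_walk hp ht).2.2
      rw [hw, ContinuousLinearMap.smul_comp, norm_smul, RCLike.norm_ofReal, abs_of_nonneg hθ₀]
      exact hτ.trans (by gcongr)
  · refine iSup₂_le fun t _ => EReal.coe_le_coe_iff.2 ?_
    -- Because `p` is `‖p‖ e`, the sum `e + θ (q - p)` has nonnegative coefficients `1 - θ ‖p‖` and
    -- `θ` on `e` and `q`; its norm is at most `1 + θ (1 - ‖p‖)`.
    have h₁ : e + branchSum w t =
        ((1 - θ * ‖p.toDual‖ : ℝ) : 𝕜) • e + (θ : 𝕜) • (walk A ρ p t).toDual := by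
      rw [hsum, smul_sub]
      nth_rw 1 [hpe]
      rw [smul_smul]
      push_cast
      rw [sub_smul, one_smul]
      abel
    have h₂ : 0 ≤ 1 - θ * ‖p.toDual‖ := by
      have := mul_le_one₀ hθ₁ (norm_nonneg _) p.norm_toDual_le
      linarith
    have h₃ : ‖e + branchSum w t‖ ≤ (1 - θ * ‖p.toDual‖) * 1 + θ * 1 := by
      rw [h₁]
      refine (norm_add_le _ _).trans ?_
      rw [norm_smul, norm_smul, RCLike.norm_ofReal, RCLike.norm_ofReal, abs_of_nonneg h₂,
        abs_of_nonneg hθ₀, he]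
      gcongr
      exact (walk A ρ p t).norm_toDual_le
    linarith

end DualBall

/-- A point of the iterated derivative that is far apart relative to its norm makes the convexity
modulus small. -/
theorem convexityModulus_lt {𝕜 : Type} [RCLike 𝕜]
    {X : Type u} [NormedAddCommGroup X] [NormedSpace 𝕜 X]
    {Y : Type u} [NormedAddCommGroup Y] [NormedSpace 𝕜 Y]
    {A : X →L[𝕜] Y} (hA : A ≠ 0) {ξ : Ordinal.{u}} {σ τ γ : ℝ} (hσ : 0 < σ) (hτ : 0 < τ)
    {p : DualBall 𝕜 Y} (hγ : γ ≤ ‖p.toDual‖)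
    (hp : p ∈ iterDeriv (FarApart A (4 * (σ * τ + 1 - γ) / σ)) (Ordinal.omega0 ^ ξ) Set.univ) :
    convexityModulus ξ τ A < ((σ * τ : ℝ) : EReal) := by
  have hp₁ := p.norm_toDual_le
  have hστ : 0 < σ * τ := mul_pos hσ hτ
  have hden : 0 < σ * τ + 1 - ‖p.toDual‖ := by linarith
  -- This `θ` makes `θ * (1 - ‖p‖)` strictly less than `σ * τ`, while `θ * ρ / 2 ≥ 2 * τ` because `γ
  -- ≤ ‖p‖`.
  refine (convexityModulus_le hA (θ := σ * τ / (σ * τ + 1 - ‖p.toDual‖)) (by positivity)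
    ((div_le_one hden).2 (by linarith)) ?_ hp).trans_lt (EReal.coe_lt_coe_iff.2 ?_)
  · rw [div_mul_eq_mul_div, le_div_iff₀ hden]
    have h₁ : σ * τ * (4 * (σ * τ + 1 - γ) / σ / 2) = 2 * τ * (σ * τ + 1 - γ) := by
      field_simp
      ring
    rw [h₁]
    have h₂ : τ * (σ * τ + 1 - ‖p.toDual‖) ≤ τ * (σ * τ + 1 - γ) := by gcongr
    have h₃ : 0 ≤ τ * (σ * τ + 1 - ‖p.toDual‖) := by positivity
    linarith
  · rw [div_mul_eq_mul_div, div_lt_iff₀ hden]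
    gcongr
    linarith

/-! ### Elements of the injective tensor product as functions on the product of dual balls -/

section Pairing

variable {𝕜 : Type} [RCLike 𝕜]
variable {X₀ Y₀ X₁ Y₁ : Type u}
variable [NormedAddCommGroup X₀] [NormedSpace 𝕜 X₀] [NormedAddCommGroup Y₀] [NormedSpace 𝕜 Y₀]
variable [NormedAddCommGroup X₁] [NormedSpace 𝕜 X₁] [NormedAddCommGroup Y₁] [NormedSpace 𝕜 Y₁]

/-- The real part of the value of `v` at a pair of functionals. -/
noncomputable def pairing (v : InjTensor 𝕜 Y₀ Y₁) (k : DualBall 𝕜 Y₀ × DualBall 𝕜 Y₁) : ℝ :=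
  RCLike.re (k.2.toDual (v.1 k.1.toDual))

theorem pairing_add (v w : InjTensor 𝕜 Y₀ Y₁) (k : DualBall 𝕜 Y₀ × DualBall 𝕜 Y₁) :
    pairing (v + w) k = pairing v k + pairing w k := by
  simp [pairing]

theorem pairing_sum_smul {s : Finset ℕ} (a : ℕ → ℝ) (v : ℕ → InjTensor 𝕜 Y₀ Y₁)
    (k : DualBall 𝕜 Y₀ × DualBall 𝕜 Y₁) :
    pairing (∑ i ∈ s, (a i : 𝕜) • v i) k = ∑ i ∈ s, a i * pairing (v i) k := by
  simp [pairing]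

theorem norm_apply_apply_le (v : (Y₀ →L[𝕜] 𝕜) →L[𝕜] Y₁)
    (k : DualBall 𝕜 Y₀ × DualBall 𝕜 Y₁) : ‖k.2.toDual (v k.1.toDual)‖ ≤ ‖v‖ * ‖k.1.toDual‖ := by
  calc ‖k.2.toDual (v k.1.toDual)‖ ≤ 1 * ‖v k.1.toDual‖ :=
        k.2.toDual.le_of_opNorm_le k.2.norm_toDual_le _
    _ ≤ ‖v‖ * ‖k.1.toDual‖ := by
        rw [one_mul]
        exact v.le_opNorm _

theorem pairing_le_norm (v : InjTensor 𝕜 Y₀ Y₁) (k : DualBall 𝕜 Y₀ × DualBall 𝕜 Y₁) :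
    pairing v k ≤ ‖v‖ := by
  refine ((RCLike.re_le_norm _).trans (norm_apply_apply_le v.1 k)).trans ?_
  exact mul_le_of_le_one_right (norm_nonneg _) k.1.norm_toDual_le

theorem pairing_le_norm_fst {v : InjTensor 𝕜 Y₀ Y₁} (hv : ‖v‖ ≤ 1)
    (k : DualBall 𝕜 Y₀ × DualBall 𝕜 Y₁) : pairing v k ≤ ‖k.1.toDual‖ := by
  refine ((RCLike.re_le_norm _).trans (norm_apply_apply_le v.1 k)).trans ?_
  exact mul_le_of_le_one_left (norm_nonneg _) hv

theorem pairing_le_norm_snd {v : InjTensor 𝕜 Y₀ Y₁} (hv : ‖v‖ ≤ 1)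
    (k : DualBall 𝕜 Y₀ × DualBall 𝕜 Y₁) : pairing v k ≤ ‖k.2.toDual‖ := by
  refine (RCLike.re_le_norm _).trans ((k.2.toDual.le_opNorm _).trans ?_)
  refine mul_le_of_le_one_right (norm_nonneg _) ((v.1.le_opNorm _).trans ?_)
  exact mul_le_one₀ hv (norm_nonneg _) k.1.norm_toDual_le

/-- Joint weak* continuity is clear for finite sums of elementary tensors and passes to operator
norm limits, which are uniform limits on the product of the balls. -/
theorem continuous_apply_apply {v : (Y₀ →L[𝕜] 𝕜) →L[𝕜] Y₁} (hv : v ∈ InjTensor 𝕜 Y₀ Y₁) :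
    Continuous fun k : DualBall 𝕜 Y₀ × DualBall 𝕜 Y₁ => k.2.toDual (v k.1.toDual) := by
  have hspan : ∀ w ∈ Submodule.span 𝕜 {v | ∃ (x : Y₀) (y : Y₁), v = elemTensor 𝕜 x y},
      Continuous fun k : DualBall 𝕜 Y₀ × DualBall 𝕜 Y₁ => k.2.toDual (w k.1.toDual) := by
    intro w hw
    induction hw using Submodule.span_induction with
    | mem w hw =>
      obtain ⟨x, y, rfl⟩ := hw
      simp only [elemTensor_apply, map_smul, smul_eq_mul]
      exact ((DualBall.continuous_eval x).comp continuous_fst).mul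
        ((DualBall.continuous_eval y).comp continuous_snd)
    | zero => simpa using continuous_const
    | add w w' _ _ hw hw' =>
      simp only [add_apply, map_add]
      exact hw.add hw'
    | smul c w _ hw =>
      simp only [smul_apply, map_smul, smul_eq_mul]
      exact continuous_const.mul hw
  refine continuous_of_uniform_approx_of_continuous fun U hU => ?_
  obtain ⟨ε, hε, hεU⟩ := Metric.mem_uniformity_dist.1 hU
  obtain ⟨w, hw, hvw⟩ := Metric.mem_closure_iff.1 hv ε hε
  refine ⟨_, hspan w hw, fun k => hεU ?_⟩
  rw [dist_eq_norm] at *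
  rw [← map_sub, ← sub_apply]
  refine (norm_apply_apply_le (v - w) k).trans_lt (lt_of_le_of_lt ?_ hvw)
  exact mul_le_of_le_one_right (norm_nonneg _) k.1.norm_toDual_le

theorem continuous_pairing (v : InjTensor 𝕜 Y₀ Y₁) : Continuous (pairing v) :=
  RCLike.continuous_re.comp (continuous_apply_apply v.2)

theorem norm_le_of_pairing_le {v : InjTensor 𝕜 Y₀ Y₁} {C : ℝ} (hC : ∀ k, pairing v k ≤ C) :
    ‖v‖ ≤ C := by
  have hball : ∀ f : Y₀ →L[𝕜] 𝕜, ‖f‖ ≤ 1 → ‖v.1 f‖ ≤ C := by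
    intro f hf
    obtain ⟨g, hg, hgv⟩ := exists_dual_vector'' 𝕜 (v.1 f)
    have := hC (DualBall.ofDual f hf, DualBall.ofDual g hg)
    rwa [pairing, DualBall.toDual_ofDual, DualBall.toDual_ofDual, hgv, RCLike.ofReal_re] at this
  have hC₀ : 0 ≤ C := (norm_nonneg _).trans (hball 0 (by simp))
  refine ContinuousLinearMap.opNorm_le_bound v.1 hC₀ fun f => ?_
  rcases eq_or_ne f 0 with rfl | hf
  · simp
  have hf' : 0 < ‖f‖ := norm_pos_iff.2 hf
  have h := hball ((‖f‖ : 𝕜)⁻¹ • f) (by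
    rw [norm_smul, norm_inv, RCLike.norm_ofReal, abs_norm, inv_mul_cancel₀ hf'.ne'])
  rw [map_smul, norm_smul, norm_inv, RCLike.norm_ofReal, abs_norm, inv_mul_le_iff₀ hf'] at h
  linarith

theorem pairing_add_tensorMap_sum (A₀ : X₀ →L[𝕜] Y₀) (A₁ : X₁ →L[𝕜] Y₁) (y : InjTensor 𝕜 Y₀ Y₁)
    {s : Finset ℕ} (a : ℕ → ℝ) (x : ℕ → InjTensor 𝕜 X₀ X₁)
    (k : DualBall 𝕜 Y₀ × DualBall 𝕜 Y₁) :
    pairing (y + tensorMap A₀ A₁ (∑ i ∈ s, (a i : 𝕜) • x i)) k =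
      pairing y k + ∑ i ∈ s, a i * pairing (tensorMap A₀ A₁ (x i)) k := by
  have h : tensorMap A₀ A₁ (∑ i ∈ s, (a i : 𝕜) • x i) =
      ∑ i ∈ s, (a i : 𝕜) • tensorMap A₀ A₁ (x i) := by
    rw [map_sum]
    exact Finset.sum_congr rfl fun i _ => map_smul _ _ _
  rw [h, ← pairing_sum_smul]
  exact pairing_add _ _ _

/-- The sum of the distances of the images of two pairs of functionals under the adjoints. -/
noncomputable def adjointDist (A₀ : X₀ →L[𝕜] Y₀) (A₁ : X₁ →L[𝕜] Y₁)
    (p q : DualBall 𝕜 Y₀ × DualBall 𝕜 Y₁) : ℝ :=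
  ‖(p.1.toDual - q.1.toDual).comp A₀‖ + ‖(p.2.toDual - q.2.toDual).comp A₁‖

/-- Bilinearity: change one functional at a time, bounding the adjoint image of the other by `R`. -/
theorem pairing_tensorMap_le (A₀ : X₀ →L[𝕜] Y₀) (A₁ : X₁ →L[𝕜] Y₁) (v : InjTensor 𝕜 X₀ X₁)
    (p q : DualBall 𝕜 Y₀ × DualBall 𝕜 Y₁) :
    pairing (tensorMap A₀ A₁ v) p ≤
      pairing (tensorMap A₀ A₁ v) q + max ‖A₀‖ ‖A₁‖ * ‖v‖ * adjointDist A₀ A₁ p q := by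
  set R := max ‖A₀‖ ‖A₁‖
  have hcomp : ∀ (f : DualBall 𝕜 Y₀), ‖f.toDual.comp A₀‖ ≤ R := fun f =>
    (f.toDual.opNorm_comp_le A₀).trans ((mul_le_of_le_one_left (norm_nonneg _)
      f.norm_toDual_le).trans (le_max_left _ _))
  have hcomp' : ∀ (f : DualBall 𝕜 Y₁), ‖f.toDual.comp A₁‖ ≤ R := fun f =>
    (f.toDual.opNorm_comp_le A₁).trans ((mul_le_of_le_one_left (norm_nonneg _)
      f.norm_toDual_le).trans (le_max_right _ _))
  have heq : ∀ k : DualBall 𝕜 Y₀ × DualBall 𝕜 Y₁, pairing (tensorMap A₀ A₁ v) k =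
      RCLike.re ((k.2.toDual.comp A₁) (v.1 (k.1.toDual.comp A₀))) := fun _ => rfl
  have hdiff : (p.2.toDual.comp A₁) (v.1 (p.1.toDual.comp A₀)) =
      (q.2.toDual.comp A₁) (v.1 (q.1.toDual.comp A₀)) +
      (((p.2.toDual - q.2.toDual).comp A₁) (v.1 (p.1.toDual.comp A₀)) +
        (q.2.toDual.comp A₁) (v.1 ((p.1.toDual - q.1.toDual).comp A₀))) := by
    rw [ContinuousLinearMap.sub_comp, ContinuousLinearMap.sub_comp, map_sub, map_sub, sub_apply]
    ring
  have h₁ : ‖((p.2.toDual - q.2.toDual).comp A₁) (v.1 (p.1.toDual.comp A₀))‖ ≤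
      ‖(p.2.toDual - q.2.toDual).comp A₁‖ * (‖v‖ * R) := by
    refine (ContinuousLinearMap.le_opNorm _ _).trans ?_
    gcongr
    exact (v.1.le_opNorm _).trans (mul_le_mul_of_nonneg_left (hcomp _) (norm_nonneg _))
  have h₂ : ‖(q.2.toDual.comp A₁) (v.1 ((p.1.toDual - q.1.toDual).comp A₀))‖ ≤
      R * (‖v‖ * ‖(p.1.toDual - q.1.toDual).comp A₀‖) := by
    refine (ContinuousLinearMap.le_opNorm _ _).trans ?_
    exact mul_le_mul (hcomp' _) (v.1.le_opNorm _) (norm_nonneg _)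
      ((norm_nonneg _).trans (le_max_left _ _))
  rw [heq, heq, hdiff, map_add, map_add, adjointDist]
  have h₃ := (RCLike.re_le_norm _).trans h₁
  have h₄ := (RCLike.re_le_norm _).trans h₂
  linarith

/-- The image under `tensorMap` of a weakly null net converges pointwise to zero. -/
theorem tendsto_pairing_tensorMap {A₀ : X₀ →L[𝕜] Y₀} {A₁ : X₁ →L[𝕜] Y₁} {D : Type u} {l : Filter D}
    {x : D → InjTensor 𝕜 X₀ X₁}
    (hx : ∀ f : InjTensor 𝕜 X₀ X₁ →L[𝕜] 𝕜, Tendsto (fun u => f (x u)) l (𝓝 0))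
    (k : DualBall 𝕜 Y₀ × DualBall 𝕜 Y₁) :
    Tendsto (fun u => pairing (tensorMap A₀ A₁ (x u)) k) l (𝓝 0) := by
  let f : InjTensor 𝕜 X₀ X₁ →L[𝕜] 𝕜 := (k.2.toDual.comp A₁).comp
    ((ContinuousLinearMap.apply 𝕜 X₁ (k.1.toDual.comp A₀)).comp (InjTensor 𝕜 X₀ X₁).subtypeL)
  have h := (RCLike.continuous_re (K := 𝕜)).continuousAt.tendsto.comp (hx f)
  rw [map_zero] at h
  exact h

/-- Two pairs of functionals are related when their images under the adjoints are far apart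
compared to the difference of `b + 1` and the value of `y`. -/
def PairingRel (A₀ : X₀ →L[𝕜] Y₀) (A₁ : X₁ →L[𝕜] Y₁) (σ b : ℝ) (y : InjTensor 𝕜 Y₀ Y₁)
    (p q : DualBall 𝕜 Y₀ × DualBall 𝕜 Y₁) : Prop :=
  8 * (b + 1 - pairing y p) / σ ≤ adjointDist A₀ A₁ p q

variable {A₀ : X₀ →L[𝕜] Y₀} {A₁ : X₁ →L[𝕜] Y₁} {σ b : ℝ} {y : InjTensor 𝕜 Y₀ Y₁}

/-- By compactness it is enough to work near one point `k`, in a neighbourhood without related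
pairs. There `pairing_tensorMap_le` compares `q` with `k`; the constants satisfy `R * (σ / (8 * R))
* (8 / σ) = 1`, so the change is at most `b + 1 - pairing y q`, and the value at `k` tends to `0`.
-/
theorem eventually_pairing_le (hA₀ : A₀ ≠ 0) (hσ : 0 < σ) {D : Type u} {l : Filter D}
    {x : D → InjTensor 𝕜 X₀ X₁}
    (hx : ∀ f : InjTensor 𝕜 X₀ X₁ →L[𝕜] 𝕜, Tendsto (fun u => f (x u)) l (𝓝 0))
    (hxs : ∀ u, ‖x u‖ ≤ σ / (8 * max ‖A₀‖ ‖A₁‖)) {L : Set (DualBall 𝕜 Y₀ × DualBall 𝕜 Y₁)}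
    (hL : IsClosed L) (hd : relDeriv (PairingRel A₀ A₁ σ b y) L = ∅) {ε : ℝ} (hε : 0 < ε) :
    ∀ᶠ u in l, ∀ q ∈ L, pairing (tensorMap A₀ A₁ (x u)) q - (b + 1 - pairing y q) ≤ ε := by
  have hR : 0 < max ‖A₀‖ ‖A₁‖ := (norm_pos_iff.2 hA₀).trans_le (le_max_left _ _)
  refine hL.isCompact.induction_on (p := fun S => ∀ᶠ u in l, ∀ q ∈ S,
    pairing (tensorMap A₀ A₁ (x u)) q - (b + 1 - pairing y q) ≤ ε) (by simp)
    (fun S S' hSS' hS' => hS'.mono fun u hu q hq => hu q (hSS' hq))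
    (fun S S' hS hS' => (hS.and hS').mono fun u hu q hq => hq.elim (hu.1 q) (hu.2 q))
    fun k hk => ?_
  have hV : ∃ V ∈ 𝓝 k, ∀ p ∈ V ∩ L, ∀ q ∈ V ∩ L, ¬ PairingRel A₀ A₁ σ b y p q := by
    by_contra! hcon
    exact Set.notMem_empty k (hd ▸ ⟨hk, hcon⟩)
  obtain ⟨V, hV, hVr⟩ := hV
  refine ⟨V ∩ L, inter_mem (mem_nhdsWithin_of_mem_nhds hV) self_mem_nhdsWithin, ?_⟩
  have htend := tendsto_pairing_tensorMap (A₀ := A₀) (A₁ := A₁) hx k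
  filter_upwards [htend.eventually_lt_const hε] with u hu q hq
  have h₁ := pairing_tensorMap_le A₀ A₁ (x u) q k
  have h₂ := not_le.1 (hVr q hq k ⟨mem_of_mem_nhds hV, hk⟩)
  have h₃ : max ‖A₀‖ ‖A₁‖ * ‖x u‖ * adjointDist A₀ A₁ q k ≤
      max ‖A₀‖ ‖A₁‖ * (σ / (8 * max ‖A₀‖ ‖A₁‖)) * (8 * (b + 1 - pairing y q) / σ) := by
    have : 0 ≤ adjointDist A₀ A₁ q k := add_nonneg (norm_nonneg _) (norm_nonneg _)
    have := hxs u
    gcongr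
  have h₄ : max ‖A₀‖ ‖A₁‖ * (σ / (8 * max ‖A₀‖ ‖A₁‖)) * (8 * (b + 1 - pairing y q) / σ) =
      b + 1 - pairing y q := by
    field_simp
  linarith

/-- If no convex combination along a branch brings the norm below `1 + c`, then the iterated
derivative of the product of the dual balls is nonempty. -/
theorem nonempty_iterDeriv_pairingRel (hA₀ : A₀ ≠ 0) (hσ : 0 < σ) {c : ℝ} (hb : 0 ≤ b)
    (hbc : b < c) (hy : ‖y‖ ≤ 1) {Λ D : Type u} [Preorder D] [IsDirected D (· ≤ ·)] [Nonempty D]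
    {T : Set (List Λ)} (hT : IsTree T) {ξ : Ordinal.{u}} (hord : HasOrder T (Ordinal.omega0 ^ ξ))
    {x : List (Λ × D) → InjTensor 𝕜 X₀ X₁} (hx : IsWeaklyNull 𝕜 T x)
    (hxs : ∀ t ∈ treeDot T D, ‖x t‖ ≤ σ / (8 * max ‖A₀‖ ‖A₁‖))
    (hc : ∀ t ∈ treeDot T D, ∀ z ∈ branchHull 𝕜 x t, c < ‖y + tensorMap A₀ A₁ z‖ - 1) :
    (iterDeriv (PairingRel A₀ A₁ σ b y) (Ordinal.omega0 ^ ξ) Set.univ).Nonempty := by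
  rw [Set.nonempty_iff_ne_empty]
  intro hempty
  let h : List (Λ × D) → C(DualBall 𝕜 Y₀ × DualBall 𝕜 Y₁, ℝ) := fun t =>
    ⟨fun k => pairing (tensorMap A₀ A₁ (x t)) k - (b + 1 - pairing y k),
      (continuous_pairing _).sub (continuous_const.sub (continuous_pairing _))⟩
  have hh : ∀ t k, h t k = pairing (tensorMap A₀ A₁ (x t)) k - (b + 1 - pairing y k) :=
    fun _ _ => rfl
  have hM : ∀ t ∈ treeDot T D, ∀ k,
      h t k ≤ ‖tensorMap A₀ A₁‖ * (σ / (8 * max ‖A₀‖ ‖A₁‖)) := by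
    intro t ht k
    have h₁ := pairing_le_norm (tensorMap A₀ A₁ (x t)) k
    have h₂ := (tensorMap A₀ A₁).le_opNorm_of_le (hxs t ht)
    have h₃ := (pairing_le_norm y k).trans hy
    rw [hh]
    linarith
  obtain ⟨t, ht, a, ha₀, ha₁, hle⟩ := exists_small_convex_combination hT hord
    (by positivity) hM
    (fun t a hta L hL hd ε hε => eventually_pairing_le hA₀ hσ (hx t a hta)
      (fun u => hxs _ (hta u)) hL hd hε) hempty (ε := (c - b) / 2) (by linarith)
  have hz := hc t ht _ ⟨a, ha₀, ha₁, rfl⟩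
  -- As the weights sum to `1`, the small average of `h` bounds the pairing by `b + 1` plus half the
  -- gap, still below `1 + c`.
  refine absurd (norm_le_of_pairing_le (C := 1 + b + (c - b) / 2) fun k => ?_)
    (not_le.2 (lt_of_le_of_lt (by linarith) (lt_sub_iff_add_lt'.1 hz)))
  have hk := hle k
  simp only [hh, mul_sub, Finset.sum_sub_distrib] at hk
  simp only [← Finset.sum_mul, ha₁] at hk
  rw [pairing_add_tensorMap_sum]
  linarith

/-- A point of the iterated derivative of the product of the dual balls has a coordinate in the
iterated derivative of a dual ball. -/
theorem farApart_of_mem_iterDeriv_pairingRel (hσ : 0 < σ) {a : ℝ} (hab : a < b) {ξ : Ordinal.{u}}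
    {k : DualBall 𝕜 Y₀ × DualBall 𝕜 Y₁}
    (hk : k ∈ iterDeriv (PairingRel A₀ A₁ σ b y) (Ordinal.omega0 ^ ξ) Set.univ) :
    k.1 ∈ iterDeriv (FarApart A₀ (4 * (a + 1 - pairing y k) / σ)) (Ordinal.omega0 ^ ξ) Set.univ ∨
      k.2 ∈ iterDeriv (FarApart A₁ (4 * (a + 1 - pairing y k) / σ)) (Ordinal.omega0 ^ ξ)
        Set.univ := by
  -- The slack `b - a` freezes the varying threshold at its value at `k`. A sum of two distances of
  -- at least `8 * (a + 1 - pairing y k) / σ` then has a term of at least half that.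
  have hW : IsOpen {p | pairing y p < pairing y k + (b - a)} :=
    isOpen_lt (continuous_pairing y) continuous_const
  have hr : ∀ p ∈ {p | pairing y p < pairing y k + (b - a)},
      ∀ q ∈ {p | pairing y p < pairing y k + (b - a)}, PairingRel A₀ A₁ σ b y p q →
        FarApart A₀ (4 * (a + 1 - pairing y k) / σ) p.1 q.1 ∨
          FarApart A₁ (4 * (a + 1 - pairing y k) / σ) p.2 q.2 := by
    intro p hp q _ hpq
    by_contra! hcon
    have h₁ := not_le.1 hcon.1
    have h₂ := not_le.1 hcon.2
    have h₃ : 8 * (b + 1 - pairing y p) / σ ≤ adjointDist A₀ A₁ p q := hpq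
    have h₄ : pairing y p < pairing y k + (b - a) := hp
    have h₅ : 8 * (a + 1 - pairing y k) / σ ≤ 8 * (b + 1 - pairing y p) / σ := by
      gcongr ?_ / σ
      linarith
    have h₆ : 8 * (a + 1 - pairing y k) / σ =
        4 * (a + 1 - pairing y k) / σ + 4 * (a + 1 - pairing y k) / σ := by ring
    rw [adjointDist] at h₃
    linarith
  exact mem_iterDeriv_fst_or_snd hW hr (show pairing y k < _ by linarith) hk

end Pairing

end XiAsymptotic

/-! ### Smoothness of the tensor product of two operators -/

theorem lemma5p5 {𝕜 : Type} [RCLike 𝕜] {X₀ Y₀ X₁ Y₁ : Type u}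
    [NormedAddCommGroup X₀] [NormedSpace 𝕜 X₀] [CompleteSpace X₀]
    [NormedAddCommGroup Y₀] [NormedSpace 𝕜 Y₀] [CompleteSpace Y₀]
    [NormedAddCommGroup X₁] [NormedSpace 𝕜 X₁] [CompleteSpace X₁]
    [NormedAddCommGroup Y₁] [NormedSpace 𝕜 Y₁] [CompleteSpace Y₁]
    (A₀ : X₀ →L[𝕜] Y₀) (A₁ : X₁ →L[𝕜] Y₁) (hA₀ : A₀ ≠ 0) (hA₁ : A₁ ≠ 0)
    (ξ : Ordinal.{u}) (σ τ : ℝ) (hσ : 0 < σ) (hτ : 0 < τ)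
    (hδ : ((σ * τ : ℝ) : EReal) ≤
      min (XiAsymptotic.convexityModulus ξ τ A₀) (XiAsymptotic.convexityModulus ξ τ A₁)) :
    XiAsymptotic.smoothnessModulus ξ (σ / (8 * max ‖A₀‖ ‖A₁‖)) (XiAsymptotic.tensorMap A₀ A₁) ≤
      ((σ * τ : ℝ) : EReal) := by
  open XiAsymptotic in
  refine sSup_le ?_
  rintro _ ⟨Λ, D, _, _, _, T, y, x, hT, hord, hy, hx, hxs, rfl⟩
  by_contra! hlt
  -- Two gaps are needed: `b < c` absorbs the error of averaging, and `σ * τ < b` absorbs the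
  -- variation of `pairing y` near `k`.
  obtain ⟨c, hc, hcinf⟩ := EReal.lt_iff_exists_real_btwn.1 hlt
  rw [EReal.coe_lt_coe_iff] at hc
  obtain ⟨b, hab, hbc⟩ := exists_between hc
  obtain ⟨k, hk⟩ := nonempty_iterDeriv_pairingRel hA₀ hσ ((mul_pos hσ hτ).trans hab).le hbc hy
    hT hord hx hxs fun t ht z hz =>
      EReal.coe_lt_coe_iff.1 (hcinf.trans_le ((iInf₂_le t ht).trans (iInf₂_le z hz)))
  rcases farApart_of_mem_iterDeriv_pairingRel hσ hab hk with hk' | hk'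
  · exact ((hδ.trans (min_le_left _ _)).trans_lt
      (convexityModulus_lt hA₀ hσ hτ (pairing_le_norm_fst hy k) hk')).false
  · exact ((hδ.trans (min_le_right _ _)).trans_lt
      (convexityModulus_lt hA₁ hσ hτ (pairing_le_norm_snd hy k) hk')).false
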